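/- Let $M$ be a smooth manifold (finite-dimensional, without boundary, Hausdorff, paracompact) modelled on a finite-dimensional real vector space $E$, let $\varphi \in \operatorname{Diff}(M)$ and $I = [0,1]$. Let $\mathscr{P}M := C(I,M)$ carry the compact-open topology, and define the continuous free twisted loop space $$\mathscr{L}_\varphi M := \{\gamma \in C(I,M) : \gamma(1) = \varphi(\gamma(0))\} \subseteq \mathscr{P}M$$ with the subspace topology. A local addition is a map $\alpha \colon U \to M$ on an open set $U \subseteq TM$ such that $(\pi,\alpha)$ is a diffeomorphism of $U$ onto an open subset of $M \times M$ and $\alpha(0_x) = x$ whenever $0_x \in U$ (for example, a Riemannian exponential map near the zero section). For $\gamma \in \mathscr{P}M$ with $0_{\gamma(t)} \in U$ for all $t \in I$, the inverse of $X \mapsto \alpha \circ X$, defined for continuous sections $X$ of $\gamma^*TM$ with values in $U$, is a chart of $\mathscr{P}M$ with values in the Banach space $\Gamma^0(\gamma^*TM) \cong C(I,E)$, where the isomorphism is given by a continuous trivialisation of $\gamma^*TM$. These charts cover $\mathscr{P}M$ and are the charts of a smooth Banach manifold structure on $\mathscr{P}M$. With respect to this structure the following holds. The space $\mathscr{L}_\varphi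 M$ admits the structure of a smooth Banach manifold, modelled on $\{f \in C(I,E) : f(0)=f(1)\}$, such that the maps in the square $$\begin{array}{ccc} \mathscr{L}_\varphi M & \hookrightarrow & \mathscr{P}M \\ {\scriptstyle \mathrm{ev}_0}\downarrow & & \downarrow{\scriptstyle (\mathrm{ev}_0,\mathrm{ev}_1)} \\ M & \xrightarrow{\ \Gamma_\varphi\ } & M \times M \end{array}$$ with $\mathrm{ev}_t(\gamma) = \gamma(t)$ and $\Gamma_\varphi(x) = (x,\varphi(x))$, are smooth, and the square is a pullback in the category of (Hausdorff) smooth Banach manifolds and smooth maps; that is, $\mathscr{L}_\varphi M$ is the pullback of $(\mathrm{ev}_0,\mathrm{ev}_1)$ along the graph of $\varphi$. Moreover, all evaluations $\mathrm{ev}_t \colon \mathscr{L}_\varphi M \to M$ are smooth, and for every $\gamma \in \mathscr{L}_\varphi M$ the map $\xi \mapsto \big(t \mapsto D(\mathrm{ev}_t)_\gamma\, \xi\big)$, which is linear at each $t$, is a homeomorphism of $T_\gamma \mathscr{L}_\varphi M$ onto $$\{X \in \Gamma^0(\gamma^*TM) : X(1) = D\varphi(X(0))\},$$ where the latter space carries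 the compact-open topology of $C(I,TM)$. In this sense, $T_\gamma \mathscr{L}_\varphi M = \{X \in \Gamma^0(\gamma^*TM) : X(1) = D\varphi(X(0))\}$. -/

import Mathlib

open scoped Manifold ContDiff unitInterval Bundle

universe u v

/-! ### The category of smooth Banach manifolds -/

/-- A smooth Banach manifold: a Hausdorff space `carrier` with a smooth atlas (without boundary)
modelled on the real Banach space `model`. -/
structure BanachMfd where
  carrier : Type u
  model : Type v
  [normedAddCommGroup : NormedAddCommGroup model]
  [normedSpace : NormedSpace ℝ model]
  [completeSpace : CompleteSpace model]
  [topologicalSpace : TopologicalSpace carrier]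
  [t2Space : T2Space carrier]
  [chartedSpace : ChartedSpace model carrier]
  [isManifold : IsManifold 𝓘(ℝ, model) ∞ carrier]

namespace BanachMfd

attribute [instance] normedAddCommGroup normedSpace completeSpace topologicalSpace t2Space
  chartedSpace isManifold

/-- The category of smooth Banach manifolds; morphisms are the smooth maps. -/
noncomputable instance : CategoryTheory.Category BanachMfd.{u, v} where
  Hom X Y := C^∞⟮𝓘(ℝ, X.model), X.carrier; 𝓘(ℝ, Y.model), Y.carrier⟯
  id _ := ContMDiffMap.id
  comp f g := ContMDiffMap.comp g f

/-- The underlying map of a morphism of Banach manifolds. -/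
noncomputable def Hom.map {X Y : BanachMfd.{u, v}} (f : X ⟶ Y) : X.carrier → Y.carrier :=
  DFunLike.coe (F := C^∞⟮𝓘(ℝ, X.model), X.carrier; 𝓘(ℝ, Y.model), Y.carrier⟯) f

/-- The Banach manifold with underlying space `X` and model space `F`. -/
noncomputable abbrev of (F : Type v) [NormedAddCommGroup F] [NormedSpace ℝ F] [CompleteSpace F]
    (X : Type u) [TopologicalSpace X] [T2Space X] [ChartedSpace F X]
    [IsManifold 𝓘(ℝ, F) ∞ X] : BanachMfd.{u, v} where
  carrier := X
  model := F

/-- The product of two Banach manifolds, with the product charts. -/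
noncomputable def prod (X Y : BanachMfd.{u, v}) : BanachMfd.{u, v} where
  carrier := X.carrier × Y.carrier
  model := X.model × Y.model
  chartedSpace := inferInstanceAs
    (ChartedSpace (ModelProd X.model Y.model) (X.carrier × Y.carrier))
  isManifold := by
    rw [modelWithCornersSelf_prod]
    exact IsManifold.prod X.carrier Y.carrier

end BanachMfd

/-! ### The smooth structure of the path space `C(I, M)` -/

section PathSpace

instance finiteDimensional_completeSpace (E : Type v) [NormedAddCommGroup E] [NormedSpace ℝ E]
    [FiniteDimensional ℝ E] : CompleteSpace E :=
  FiniteDimensional.complete ℝ E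

variable (E : Type v) [NormedAddCommGroup E] [NormedSpace ℝ E]
  (M : Type u) [TopologicalSpace M] [ChartedSpace E M] [IsManifold 𝓘(ℝ, E) ∞ M]

/-- A (partially defined) local addition on `M`, given by the map `ξ ↦ (π ξ, α ξ)`: a
diffeomorphism of an open subset of `TM` onto an open subset of `M × M`, lying over the first
projection, and sending a zero vector `0 ∈ T_x M` of its domain to `(x, x)`. For instance, `α` may
be the exponential map of a Riemannian metric, on a small neighbourhood of the zero section. -/
structure LocalAddition where
  toHomeo : OpenPartialHomeomorph (TangentBundle 𝓘(ℝ, E) M) (M × M)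
  fst_eq : ∀ ξ ∈ toHomeo.source, (toHomeo ξ).1 = ξ.proj
  map_zero : ∀ x : M, (⟨x, 0⟩ : TangentBundle 𝓘(ℝ, E) M) ∈ toHomeo.source →
    toHomeo ⟨x, 0⟩ = (x, x)
  smooth : ContMDiffOn (𝓘(ℝ, E).tangent) (𝓘(ℝ, E).prod 𝓘(ℝ, E)) ∞ toHomeo toHomeo.source
  smooth_symm : ContMDiffOn (𝓘(ℝ, E).prod 𝓘(ℝ, E)) (𝓘(ℝ, E).tangent) ∞ toHomeo.symm
    toHomeo.target

/-- A continuous frame of `TM` along the path `γ`, that is, a trivialisation of `γ^*TM`. -/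
structure FrameAlong (γ : C(I, M)) where
  equiv : ∀ t : I, E ≃L[ℝ] TangentSpace 𝓘(ℝ, E) (γ t)
  continuous : Continuous fun p : I × E =>
    (⟨γ p.1, equiv p.1 p.2⟩ : TangentBundle 𝓘(ℝ, E) M)

/-- The charts of `C(I, M)`. The chart centred at `γ` is the inverse of `X ↦ α ∘ X`, for `X` a
continuous section of `γ^*TM` with values in the domain of the local addition `α`; the space of
continuous sections of `γ^*TM` is identified with `C(I, E)` through a continuous frame. -/
def IsPathChart (e : OpenPartialHomeomorph C(I, M) C(I, E)) : Prop :=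
  ∃ (α : LocalAddition E M) (γ : C(I, M)) (A : FrameAlong E M γ),
    (∀ t, (⟨γ t, 0⟩ : TangentBundle 𝓘(ℝ, E) M) ∈ α.toHomeo.source) ∧
    e.target = {f | ∀ t, (⟨γ t, A.equiv t (f t)⟩ : TangentBundle 𝓘(ℝ, E) M) ∈
      α.toHomeo.source} ∧
    ∀ f ∈ e.target, ∀ t, e.symm f t = (α.toHomeo ⟨γ t, A.equiv t (f t)⟩).2

/-- The given smooth manifold structure on `C(I, M)` is the standard one: the charts `X ↦ α ∘ X` cover
`C(I, M)` (with the compact-open topology) and are charts of the given smooth structure. -/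
structure IsPathManifold [ChartedSpace C(I, E) C(I, M)] : Prop where
  covers : ∀ γ : C(I, M), ∃ e, IsPathChart E M e ∧ γ ∈ e.source
  mem_maximalAtlas : ∀ e, IsPathChart E M e →
    e ∈ IsManifold.maximalAtlas 𝓘(ℝ, C(I, E)) ∞ C(I, M)

/-- The Banach space of continuous closed paths in `E`, a closed subspace of `C(I, E)`. It serves
as the model space of the twisted loop space. -/
def closedPaths : Submodule ℝ C(I, E) where
  carrier := {f | f 0 = f 1}
  add_mem' := by
    intro f g hf hg
    simp only [Set.mem_ofPred_eq, ContinuousMap.add_apply] at *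
    rw [hf, hg]
  zero_mem' := by simp
  smul_mem' := by
    intro c f hf
    simp only [Set.mem_ofPred_eq, ContinuousMap.smul_apply] at *
    rw [hf]

theorem isClosed_closedPaths : IsClosed (closedPaths E : Set C(I, E)) :=
  isClosed_eq (continuous_eval_const (0 : I)) (continuous_eval_const (1 : I))

instance [CompleteSpace E] : CompleteSpace (closedPaths E) :=
  (isClosed_closedPaths E).completeSpace_coe

end PathSpace

/-- The continuous free twisted loop space of `φ`, with the compact-open topology. -/
abbrev TwistedLoopSpace {M : Type u} [TopologicalSpace M] (φ : M → M) : Type u :=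
  {γ : C(I, M) // γ 1 = φ (γ 0)}

/-! The endpoint condition can be straightened explicitly. In a path chart a path `η` near the
centre `γ` is written `η t = k (t, f t)` with `f ∈ C(I, E)` and `k (t, v) = α (A_t v)`
(`LocalAddition.kernel`). There `η 1 = φ (η 0)` reads `f 1 = h (f 0)`, where `h`
(`LocalAddition.twist`) is `φ` in the charts `k (0, ·)` and `k (1, ·)`. The shear `f ↦ f + t • (f 0
- h (f 0))` fixes `f 0`, so it has an explicit smooth inverse, and it turns the condition into `f 0
= f 1`. The twisted loop space is thus a submanifold modelled on the complemented subspace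
`closedPaths E`; no implicit function theorem in Banach spaces is needed. Its inclusion is initial
for smooth maps (`contMDiff_of_slice_val`), and as a set it is the preimage of the graph of `φ`,
hence it is the pullback.

The path charts are compatible because a transition map is a superposition operator `f ↦ (t ↦ g (t,
f t))` with `g` continuous in `t` and smooth in the vector. Such operators are smooth by the omega
lemma `contDiffAt_superposition`. Its hypothesis `ParamSmoothAt` factors `g` locally as `G (c t,
v)`, a form preserved by composition, pairing and fibre derivatives.

Path charts around every path require a local addition near its compact image
(`exists_localAddition`). It is the inverse of a map `M × M → TM` made of cut-off coordinate
differences, which is a local diffeomorphism along the relevant part of the diagonal and injective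
near it.

For the tangent spaces, the derivatives of `k (t, ·)` along `η` form a frame `B` of `η^*TM`, and the
chain rule gives `D(ev_t) ξ = B_t ((G ξ) t)`, where `G` is the derivative of the path chart
restricted to the loop space. The range of `G` is `{f | f 1 = h' (f 0)}` with `h'` the derivative of
`h`. Differentiating `φ ∘ k (0, ·) = k (1, ·) ∘ h` gives `Dφ ∘ B_0 = B_1 ∘ h'`, so this becomes `X 1
= Dφ (X 0)`. -/

open Filter Topology

/-! ### Maps depending smoothly on a vector and continuously on a parameter -/

section ParamSmooth

variable {T : Type*} [TopologicalSpace T] {E : Type v} [NormedAddCommGroup E] [NormedSpace ℝ E]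
  {F : Type*} [NormedAddCommGroup F] [NormedSpace ℝ F] {H : Type*} [TopologicalSpace H]
  {J : ModelWithCorners ℝ F H} {N : Type*} [TopologicalSpace N] [ChartedSpace H N]
  {F' : Type*} [NormedAddCommGroup F'] [NormedSpace ℝ F'] {H' : Type*} [TopologicalSpace H']
  {J' : ModelWithCorners ℝ F' H'} {N' : Type*} [TopologicalSpace N'] [ChartedSpace H' N']

/-- A map `g : T × E → N` is parametrically smooth at `z` if, near `z`, it has the form
`(t, v) ↦ G (c t, v)` with `c` continuous and `G` smooth. -/
def ParamSmoothAt (J : ModelWithCorners ℝ F H) (g : T × E → N) (z : T × E) : Prop :=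
  ∃ (Q : Type v) (_ : NormedAddCommGroup Q) (_ : NormedSpace ℝ Q) (c : T → Q) (G : Q × E → N),
    (∀ᶠ t in 𝓝 z.1, ContinuousAt c t) ∧
    (∀ᶠ y in 𝓝 (c z.1, z.2), ContMDiffAt 𝓘(ℝ, Q × E) J ∞ G y) ∧
    ∀ᶠ w in 𝓝 z, g w = G (c w.1, w.2)

omit [NormedSpace ℝ E] in
theorem ContinuousAt.graph_tendsto {Q : Type*} [TopologicalSpace Q] {c : T → Q} {z : T × E}
    (hc : ContinuousAt c z.1) :
    Tendsto (fun w : T × E => (c w.1, w.2)) (𝓝 z) (𝓝 (c z.1, z.2)) :=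
  (ContinuousAt.comp (g := c) hc continuousAt_fst).prodMk continuousAt_snd

namespace ParamSmoothAt

variable {g : T × E → N} {z : T × E}

theorem congr {g' : T × E → N} (hg : ParamSmoothAt J g z) (h : g' =ᶠ[𝓝 z] g) :
    ParamSmoothAt J g' z := by
  obtain ⟨Q, i1, i2, c, G, hc, hG, hgG⟩ := hg
  exact ⟨Q, i1, i2, c, G, hc, hG, by filter_upwards [h, hgG] with w h1 h2 using h1.trans h2⟩

theorem continuousAt (hg : ParamSmoothAt J g z) : ContinuousAt g z := by
  obtain ⟨Q, i1, i2, c, G, hc, hG, hgG⟩ := hg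
  have h1 : ContinuousAt (fun w : T × E => G (c w.1, w.2)) z :=
    ContinuousAt.comp (g := G) hG.self_of_nhds.continuousAt hc.self_of_nhds.graph_tendsto
  exact h1.congr (hgG.mono fun w hw => hw.symm)

theorem eventually (hg : ParamSmoothAt J g z) : ∀ᶠ w in 𝓝 z, ParamSmoothAt J g w := by
  obtain ⟨Q, i1, i2, c, G, hc, hG, hgG⟩ := hg
  filter_upwards [continuousAt_fst.eventually hc.eventually_nhds,
    hc.self_of_nhds.graph_tendsto.eventually hG.eventually_nhds, hgG.eventually_nhds]
    with w h1 h2 h3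
  exact ⟨Q, i1, i2, c, G, h1, h2, h3⟩

theorem comp {g : T × E → N} {f : N → N'} (hf : ∀ᶠ y in 𝓝 (g z), ContMDiffAt J J' ∞ f y)
    (hg : ParamSmoothAt J g z) : ParamSmoothAt J' (fun w => f (g w)) z := by
  have hgc := hg.continuousAt
  obtain ⟨Q, i1, i2, c, G, hc, hG, hgG⟩ := hg
  refine ⟨Q, i1, i2, c, f ∘ G, hc, ?_, hgG.mono fun w hw => by simp [hw]⟩
  rw [hgG.self_of_nhds] at hf
  filter_upwards [hG, hG.self_of_nhds.continuousAt.eventually hf] with y h1 h2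
  exact ContMDiffAt.comp y h2 h1

theorem prodMk {g : T × E → N} {g' : T × E → N'} (hg : ParamSmoothAt J g z)
    (hg' : ParamSmoothAt J' g' z) : ParamSmoothAt (J.prod J') (fun w => (g w, g' w)) z := by
  obtain ⟨Q, i1, i2, c, G, hc, hG, hgG⟩ := hg
  obtain ⟨Q', i1', i2', c', G', hc', hG', hgG'⟩ := hg'
  -- The two factorisations have unrelated parameter spaces; their product carries both parameters.
  refine ⟨Q × Q', inferInstance, inferInstance, fun t => (c t, c' t),
    fun y => (G (y.1.1, y.2), G' (y.1.2, y.2)), ?_, ?_, ?_⟩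
  · filter_upwards [hc, hc'] with t h h' using h.prodMk h'
  · have e1 : ContDiff ℝ ∞ (fun y : (Q × Q') × E => (y.1.1, y.2)) := by fun_prop
    have e2 : ContDiff ℝ ∞ (fun y : (Q × Q') × E => (y.1.2, y.2)) := by fun_prop
    have t1 := (e1.continuous.tendsto ((c z.1, c' z.1), z.2)).eventually hG
    have t2 := (e2.continuous.tendsto ((c z.1, c' z.1), z.2)).eventually hG'
    filter_upwards [t1, t2] with y h1 h2
    exact ContMDiffAt.prodMk (ContMDiffAt.comp (g := G) y h1 e1.contMDiff.contMDiffAt)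
      (ContMDiffAt.comp (g := G') y h2 e2.contMDiff.contMDiffAt)
  · filter_upwards [hgG, hgG'] with w h h' using by rw [h, h']

theorem prodMk_space {G' G'' : Type*} [NormedAddCommGroup G'] [NormedSpace ℝ G']
    [NormedAddCommGroup G''] [NormedSpace ℝ G''] {g : T × E → G'} {g' : T × E → G''}
    (hg : ParamSmoothAt 𝓘(ℝ, G') g z) (hg' : ParamSmoothAt 𝓘(ℝ, G'') g' z) :
    ParamSmoothAt 𝓘(ℝ, G' × G'') (fun w => (g w, g' w)) z := by
  rw [modelWithCornersSelf_prod, ← chartedSpaceSelf_prod]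
  exact hg.prodMk hg'

theorem snd (z : T × E) : ParamSmoothAt 𝓘(ℝ, E) (fun w : T × E => w.2) z :=
  ⟨PUnit, inferInstance, inferInstance, fun _ => PUnit.unit, fun y => y.2,
    .of_forall fun _ => continuousAt_const,
    .of_forall fun _ => contDiff_snd.contMDiff.contMDiffAt, .of_forall fun _ => rfl⟩

theorem of_continuousAt {Q : Type v} [NormedAddCommGroup Q] [NormedSpace ℝ Q] {c : T → Q}
    {z : T × E} (hc : ∀ᶠ t in 𝓝 z.1, ContinuousAt c t) :
    ParamSmoothAt 𝓘(ℝ, Q) (fun w : T × E => c w.1) z :=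
  ⟨Q, inferInstance, inferInstance, c, fun y => y.1, hc,
    .of_forall fun _ => contDiff_fst.contMDiff.contMDiffAt, .of_forall fun _ => rfl⟩

theorem clm_apply {F G : Type*} [NormedAddCommGroup F] [NormedSpace ℝ F]
    [NormedAddCommGroup G] [NormedSpace ℝ G] {B : T × E → F →L[ℝ] G} {f : T × E → F}
    (hB : ParamSmoothAt 𝓘(ℝ, F →L[ℝ] G) B z) (hf : ParamSmoothAt 𝓘(ℝ, F) f z) :
    ParamSmoothAt 𝓘(ℝ, G) (fun w => B w (f w)) z := by
  have h : ContDiff ℝ ∞ (fun p : (F →L[ℝ] G) × F => p.1 p.2) := by fun_prop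
  exact (hB.prodMk_space hf).comp (f := fun p : (F →L[ℝ] G) × F => p.1 p.2)
    (.of_forall fun y => h.contMDiff.contMDiffAt)

theorem contMDiffAt_slice (hg : ParamSmoothAt J g z) :
    ContMDiffAt 𝓘(ℝ, E) J ∞ (fun v => g (z.1, v)) z.2 := by
  obtain ⟨Q, i1, i2, c, G, hc, hG, hgG⟩ := hg
  have e : ContDiff ℝ ∞ (fun v : E => (c z.1, v)) := by fun_prop
  have h1 : ContMDiffAt 𝓘(ℝ, E) J ∞ (fun v => G (c z.1, v)) z.2 :=
    ContMDiffAt.comp (g := G) z.2 hG.self_of_nhds e.contMDiff.contMDiffAt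
  refine h1.congr_of_eventuallyEq ?_
  have : Tendsto (fun v : E => (z.1, v)) (𝓝 z.2) (𝓝 z) :=
    (Continuous.prodMk_right z.1).tendsto z.2
  exact this.eventually hgG

end ParamSmoothAt

/-! ### Fibre derivatives of vector-valued parametrically smooth maps. -/

section NormedTarget

variable {F : Type v} [NormedAddCommGroup F] [NormedSpace ℝ F] {g : T × E → F} {z : T × E}

theorem fderiv_slice_eq {Q : Type*} [NormedAddCommGroup Q] [NormedSpace ℝ Q] {G : Q × E → F}
    {q : Q} {v : E} (hG : DifferentiableAt ℝ G (q, v)) :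
    HasFDerivAt (fun v => G (q, v))
      ((fderiv ℝ G (q, v)).comp (ContinuousLinearMap.inr ℝ Q E)) v := by
  have h1 : HasFDerivAt (fun v : E => (q, v)) (ContinuousLinearMap.inr ℝ Q E) v :=
    hasFDerivAt_prodMk_right q v
  exact HasFDerivAt.comp (g := G) v hG.hasFDerivAt h1

namespace ParamSmoothAt

/-- The fibre derivative of `G (c t, v)` is the partial derivative of `G` evaluated at the same `(c
t, v)`. This closure property drives the induction in the omega lemma. -/
theorem fderiv_slice (hg : ParamSmoothAt 𝓘(ℝ, F) g z) :
    ParamSmoothAt 𝓘(ℝ, E →L[ℝ] F) (fun w => fderiv ℝ (fun v => g (w.1, v)) w.2) z := by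
  obtain ⟨Q, i1, i2, c, G, hc, hG, hgG⟩ := hg
  refine ⟨Q, i1, i2, c,
    fun y => (fderiv ℝ G y).comp (ContinuousLinearMap.inr ℝ Q E), hc, ?_, ?_⟩
  · filter_upwards [hG] with y hy
    have h1 : ContDiffAt ℝ ∞ (fderiv ℝ G) y := hy.contDiffAt.fderiv_right (by simp)
    have h2 : ContDiffAt ℝ ∞ (fun y => (fderiv ℝ G y).comp (ContinuousLinearMap.inr ℝ Q E)) y :=
      h1.clm_comp contDiffAt_const
    exact h2.contMDiffAt
  · filter_upwards [hgG.eventually_nhds, hc.self_of_nhds.graph_tendsto.eventually hG] with w h1 h2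
    have hd : DifferentiableAt ℝ G (c w.1, w.2) := h2.contDiffAt.differentiableAt (by simp)
    rw [← (fderiv_slice_eq hd).fderiv]
    refine Filter.EventuallyEq.fderiv_eq ?_
    have : Tendsto (fun v : E => (w.1, v)) (𝓝 w.2) (𝓝 w) :=
      (Continuous.prodMk_right w.1).tendsto w.2
    exact this.eventually h1

/-- Strict differentiability of `G` at the single point `(c z.1, z.2)` makes the first-order
estimate uniform in nearby parameters and base points. This uniformity is what a sup-norm estimate
needs. -/
theorem fderiv_bound (hg : ParamSmoothAt 𝓘(ℝ, F) g z) {ε : ℝ} (hε : 0 < ε) :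
    ∀ᶠ p : T × E × E in 𝓝 (z.1, z.2, z.2),
      ‖g (p.1, p.2.1) - g (p.1, p.2.2) -
        fderiv ℝ (fun v => g (p.1, v)) p.2.2 (p.2.1 - p.2.2)‖ ≤ ε * ‖p.2.1 - p.2.2‖ := by
  have hD := hg.fderiv_slice.continuousAt
  have hg' := hg
  obtain ⟨Q, i1, i2, c, G, hc, hG, hgG⟩ := hg
  have hG0 := hG.self_of_nhds.contDiffAt
  have hs := (hG0.hasStrictFDerivAt (by simp)).isLittleO.def (half_pos hε)
  set f' := fderiv ℝ G (c z.1, z.2)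
  have t1 : Tendsto (fun p : T × E × E => (p.1, p.2.1)) (𝓝 (z.1, z.2, z.2)) (𝓝 z) :=
    (by fun_prop : Continuous fun p : T × E × E => (p.1, p.2.1)).tendsto _
  have t2 : Tendsto (fun p : T × E × E => (p.1, p.2.2)) (𝓝 (z.1, z.2, z.2)) (𝓝 z) :=
    (by fun_prop : Continuous fun p : T × E × E => (p.1, p.2.2)).tendsto _
  have t3 : Tendsto (fun p : T × E × E => ((c p.1, p.2.1), (c p.1, p.2.2)))
      (𝓝 (z.1, z.2, z.2)) (𝓝 ((c z.1, z.2), (c z.1, z.2))) :=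
    (hc.self_of_nhds.graph_tendsto.comp t1).prodMk_nhds (hc.self_of_nhds.graph_tendsto.comp t2)
  have hDz : fderiv ℝ (fun v => g (z.1, v)) z.2 =
      f'.comp (ContinuousLinearMap.inr ℝ Q E) := by
    rw [← (fderiv_slice_eq (hG0.differentiableAt (by simp))).fderiv]
    refine Filter.EventuallyEq.fderiv_eq ?_
    have : Tendsto (fun v : E => (z.1, v)) (𝓝 z.2) (𝓝 z) :=
      (Continuous.prodMk_right z.1).tendsto z.2
    exact this.eventually hgG
  -- Strict differentiability uses the derivative at `z`; replacing it by the derivative at the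
  -- moving base point costs the other `ε / 2`.
  have hDev : ∀ᶠ w in 𝓝 z, ‖fderiv ℝ (fun v => g (w.1, v)) w.2 -
      f'.comp (ContinuousLinearMap.inr ℝ Q E)‖ ≤ ε / 2 := by
    have := Metric.tendsto_nhds.1 hD (ε / 2) (half_pos hε)
    filter_upwards [this] with w hw
    rw [hDz, dist_eq_norm] at hw
    exact hw.le
  filter_upwards [t1.eventually hgG, t2.eventually hgG, t3.eventually hs, t2.eventually hDev]
    with p h1 h2 h3 h4
  rw [h1, h2]
  set D := fderiv ℝ (fun v => g (p.1, v)) p.2.2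
  have e1 : ((c p.1, p.2.1) - (c p.1, p.2.2) : Q × E) = (0, p.2.1 - p.2.2) := by simp
  rw [e1] at h3
  have e2 : ‖((0, p.2.1 - p.2.2) : Q × E)‖ = ‖p.2.1 - p.2.2‖ := by simp [Prod.norm_def]
  rw [e2] at h3
  calc _ = ‖(G (c p.1, p.2.1) - G (c p.1, p.2.2) - f' (0, p.2.1 - p.2.2)) -
        (D - f'.comp (ContinuousLinearMap.inr ℝ Q E)) (p.2.1 - p.2.2)‖ := by
        congr 1; simp
    _ ≤ ε / 2 * ‖p.2.1 - p.2.2‖ + ε / 2 * ‖p.2.1 - p.2.2‖ := by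
        refine (norm_sub_le _ _).trans (add_le_add h3 ?_)
        exact ContinuousLinearMap.le_of_opNorm_le _ h4 _
    _ = ε * ‖p.2.1 - p.2.2‖ := by ring

end ParamSmoothAt

/-! ### Superposition operators on spaces of continuous functions -/

open Classical in
/-- The continuous function `t ↦ g t` if this is continuous, and `d` otherwise. -/
noncomputable def ContinuousMap.mkD' {X Y : Type*} [TopologicalSpace X] [TopologicalSpace Y]
    (g : X → Y) (d : C(X, Y)) : C(X, Y) :=
  if h : Continuous g then ⟨g, h⟩ else d

theorem ContinuousMap.mkD'_apply {X Y : Type*} [TopologicalSpace X] [TopologicalSpace Y]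
    {g : X → Y} {d : C(X, Y)} (h : Continuous g) (x : X) : ContinuousMap.mkD' g d x = g x := by
  simp [ContinuousMap.mkD', h]

variable [CompactSpace T]

section PointwiseBilinear

variable {G E F : Type*} [NormedAddCommGroup G] [NormedSpace ℝ G] [NormedAddCommGroup E]
  [NormedSpace ℝ E] [NormedAddCommGroup F] [NormedSpace ℝ F]

/-- Pointwise application of a continuous bilinear map, as a continuous bilinear map. -/
noncomputable def pointwiseBilinear (T : Type*) [TopologicalSpace T] [CompactSpace T]
    (b : G →L[ℝ] E →L[ℝ] F) : C(T, G) →L[ℝ] C(T, E) →L[ℝ] C(T, F) :=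
  LinearMap.mkContinuous₂
    (LinearMap.mk₂ ℝ (fun (A : C(T, G)) (f : C(T, E)) =>
      (⟨fun t => b (A t) (f t), (b.continuous.comp A.continuous).clm_apply f.continuous⟩ : C(T, F)))
      (fun _ _ _ => by ext; simp) (fun _ _ _ => by ext; simp)
      (fun _ _ _ => by ext; simp) (fun _ _ _ => by ext; simp)) ‖b‖
    (fun A f => by
      rw [ContinuousMap.norm_le _ (by positivity)]
      intro t
      exact (b (A t)).le_of_opNorm_le_of_le
        (b.le_of_opNorm_le_of_le le_rfl (A.norm_coe_le_norm t)) (f.norm_coe_le_norm t))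

theorem pointwiseBilinear_apply (b : G →L[ℝ] E →L[ℝ] F) (A : C(T, G)) (f : C(T, E)) (t : T) :
    pointwiseBilinear T b A f t = b (A t) (f t) := rfl

theorem ContDiffAt.pointwiseBilinear {X : Type*} [NormedAddCommGroup X] [NormedSpace ℝ X]
    {n : WithTop ℕ∞} {S : X → C(T, G)} {x : X} (b : G →L[ℝ] E →L[ℝ] F)
    (hS : ContDiffAt ℝ n S x) :
    ContDiffAt ℝ n (fun f => _root_.pointwiseBilinear T b (S f)) x :=
  ContDiffAt.continuousLinearMap_comp (_root_.pointwiseBilinear T b) hS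

end PointwiseBilinear

omit [NormedSpace ℝ E] in
theorem tendsto_graph (f₀ : C(T, E)) (t : T) :
    Tendsto (fun p : C(T, E) × T => (p.2, p.1 p.2)) (𝓝 (f₀, t)) (𝓝 (t, f₀ t)) :=
  (by fun_prop : Continuous fun p : C(T, E) × T => (p.2, p.1 p.2)).tendsto _

-- Tube lemma: by compactness of `T`, a condition holding near each point of the graph of `f₀` holds
-- along the whole graph of every uniformly close `f`.
omit [NormedSpace ℝ E] in
theorem eventually_forall_graph {P : T × E → Prop} {f₀ : C(T, E)}
    (h : ∀ t, ∀ᶠ w in 𝓝 (t, f₀ t), P w) : ∀ᶠ f in 𝓝 f₀, ∀ t, P (t, f t) := by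
  have := isCompact_univ.eventually_forall_of_forall_eventually (x₀ := f₀)
    (P := fun (f : C(T, E)) t => P (t, f t)) (K := Set.univ)
    (fun t _ => (tendsto_graph f₀ t).eventually (h t))
  exact this.mono fun f hf t => hf t trivial

omit [NormedSpace ℝ E] [CompactSpace T] in
theorem continuous_graph_comp {N : Type*} [TopologicalSpace N] {g : T × E → N} {f : C(T, E)}
    (h : ∀ t, ContinuousAt g (t, f t)) : Continuous fun t => g (t, f t) := by
  rw [continuous_iff_continuousAt]
  intro t
  exact ContinuousAt.comp (g := g) (h t)
    (by fun_prop : Continuous fun t => (t, f t)).continuousAt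

-- The derivative of a superposition operator is again one, with the fibre derivative as kernel,
-- followed by the bounded linear map sending a path of operators to pointwise application. The
-- induction therefore keeps `F`, `g` and `S` general.
set_option synthInstance.maxHeartbeats 200000 in
theorem contDiffAt_superposition_nat (n : ℕ) : ∀ {F : Type v} [NormedAddCommGroup F]
    [NormedSpace ℝ F] {g : T × E → F} {S : C(T, E) → C(T, F)} {f₀ : C(T, E)}
    (_ : ∀ t, ParamSmoothAt 𝓘(ℝ, F) g (t, f₀ t))
    (_ : ∀ᶠ f in 𝓝 f₀, ∀ t, S f t = g (t, f t)), ContDiffAt ℝ n S f₀ := by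
  induction n with
  | zero =>
    intro F _ _ g S f₀ hg hS
    have h0 : ContDiffAt ℝ 0 S f₀ := by
      rw [contDiffAt_zero]
      have h1 := eventually_forall_graph (f₀ := f₀) (fun t => (hg t).eventually)
      refine ⟨_, (hS.eventually_nhds).and h1, fun f hf => ContinuousAt.continuousWithinAt ?_⟩
      obtain ⟨hf1, hf2⟩ := hf
      rw [ContinuousAt, ContinuousMap.tendsto_iff_tendstoUniformly, Metric.tendstoUniformly_iff]
      intro ε hε
      have hSf := hf1.self_of_nhds
      have hc : Continuous fun t => g (t, f t) :=
        continuous_graph_comp fun t => (hf2 t).continuousAt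
      have h2 : ∀ t, ∀ᶠ w in 𝓝 (t, f t), dist (g (w.1, f w.1)) (g w) < ε := by
        intro t
        have : ContinuousAt (fun w : T × E => dist (g (w.1, f w.1)) (g w)) (t, f t) :=
          (ContinuousAt.comp (g := fun t => g (t, f t)) hc.continuousAt continuousAt_fst).dist
            (hf2 t).continuousAt
        exact this.eventually_lt_const (by simpa using hε)
      filter_upwards [hf1, eventually_forall_graph h2] with f' h3 h4 t
      rw [hSf, h3]
      exact h4 t
    simpa using h0
  | succ n ih =>
    intro F _ _ g S f₀ hg hS
    push_cast
    rw [contDiffAt_succ_iff_hasFDerivAt]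
    -- The default value `0` is irrelevant: near `f₀` the fibre derivative along the graph of `f` is
    -- continuous in `t`.
    let S' : C(T, E) → C(T, E →L[ℝ] F) := fun f =>
      ContinuousMap.mkD' (fun t => fderiv ℝ (fun v => g (t, v)) (f t)) 0
    have h1 := eventually_forall_graph (f₀ := f₀) (fun t => (hg t).eventually)
    have hS' : ∀ f : C(T, E), (∀ t, ParamSmoothAt 𝓘(ℝ, F) g (t, f t)) →
        ∀ t, S' f t = fderiv ℝ (fun v => g (t, v)) (f t) := by
      intro f hf t
      exact ContinuousMap.mkD'_apply
        (g := fun t => fderiv ℝ (fun v => g (t, v)) (f t))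
        (continuous_graph_comp (g := fun w : T × E => fderiv ℝ (fun v => g (w.1, v)) w.2)
          fun t => (hf t).fderiv_slice.continuousAt) t
    refine ⟨fun f => pointwiseBilinear T (ContinuousLinearMap.id ℝ (E →L[ℝ] F)) (S' f),
      ⟨_, (hS.eventually_nhds).and h1, fun f hf => ?_⟩, ?_⟩
    · obtain ⟨hf1, hf2⟩ := hf
      rw [hasFDerivAt_iff_isLittleO, Asymptotics.isLittleO_iff]
      intro ε hε
      have hSf := hf1.self_of_nhds
      have hb : ∀ t, ∀ᶠ w : T × E in 𝓝 (t, f t), ‖g w - g (w.1, f w.1) -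
          fderiv ℝ (fun v => g (w.1, v)) (f w.1) (w.2 - f w.1)‖ ≤ ε * ‖w.2 - f w.1‖ := by
        intro t
        have : Tendsto (fun w : T × E => (w.1, w.2, f w.1)) (𝓝 (t, f t)) (𝓝 (t, f t, f t)) :=
          (by fun_prop : Continuous fun w : T × E => (w.1, w.2, f w.1)).tendsto _
        exact this.eventually ((hf2 t).fderiv_bound hε)
      filter_upwards [hf1, eventually_forall_graph hb] with f' h3 h4
      rw [ContinuousMap.norm_le _ (by positivity)]
      intro t
      simp only [ContinuousMap.sub_apply, pointwiseBilinear_apply, ContinuousLinearMap.id_apply]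
      rw [h3, hSf, hS' f hf2]
      refine (h4 t).trans ?_
      gcongr
      exact (f' - f).norm_coe_le_norm t
    · refine ContDiffAt.pointwiseBilinear (ContinuousLinearMap.id ℝ (E →L[ℝ] F)) ?_
      refine ih (g := fun w : T × E => fderiv ℝ (fun v => g (w.1, v)) w.2)
        (fun t => (hg t).fderiv_slice) ?_
      filter_upwards [h1] with f hf t using hS' f hf t

/-- The omega lemma: superposition operators with parametrically smooth kernel are smooth. -/
theorem contDiffAt_superposition {g : T × E → F} {S : C(T, E) → C(T, F)} {f₀ : C(T, E)}
    (hg : ∀ t, ParamSmoothAt 𝓘(ℝ, F) g (t, f₀ t))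
    (hS : ∀ᶠ f in 𝓝 f₀, ∀ t, S f t = g (t, f t)) : ContDiffAt ℝ ∞ S f₀ :=
  contDiffAt_infty.2 fun n => contDiffAt_superposition_nat n hg hS

end NormedTarget

end ParamSmooth

/-! ### Frames along paths -/

section Frames

variable {E : Type v} [NormedAddCommGroup E] [NormedSpace ℝ E]
  {M : Type u} [TopologicalSpace M] [ChartedSpace E M] [IsManifold 𝓘(ℝ, E) ∞ M]

namespace FrameAlong

variable {γ : C(I, M)} (A : FrameAlong E M γ)

/-- The tangent vector along `γ` with given coordinates. -/
noncomputable def lift (w : I × E) : TangentBundle 𝓘(ℝ, E) M := ⟨γ w.1, A.equiv w.1 w.2⟩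

/-- The coordinates of a tangent vector `ξ` at `γ t`. -/
noncomputable def coord (t : I) (ξ : TangentBundle 𝓘(ℝ, E) M) : E := (A.equiv t).symm ξ.2

theorem continuous_lift : Continuous A.lift := A.continuous

@[simp] theorem coord_lift (w : I × E) : A.coord w.1 (A.lift w) = w.2 :=
  (A.equiv w.1).symm_apply_apply w.2

theorem lift_coord {t : I} {ξ : TangentBundle 𝓘(ℝ, E) M} (h : ξ.proj = γ t) :
    A.lift (t, A.coord t ξ) = ξ := by
  obtain ⟨x, v⟩ := ξ
  dsimp only at h
  subst h
  exact congrArg (Bundle.TotalSpace.mk (γ t)) ((A.equiv t).apply_symm_apply v)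

/-- The frame in the trivialisation of the tangent bundle around `γ t₀`. -/
noncomputable def localFrame (t₀ t : I) : E →L[ℝ] E :=
  ((trivializationAt E (TangentSpace 𝓘(ℝ, E)) (γ t₀)).continuousLinearMapAt ℝ (γ t)).comp
    (A.equiv t : E →L[ℝ] TangentSpace 𝓘(ℝ, E) (γ t))

theorem localFrame_apply {t₀ t : I}
    (h : γ t ∈ (trivializationAt E (TangentSpace 𝓘(ℝ, E)) (γ t₀)).baseSet) (v : E) :
    A.localFrame t₀ t v =
      (trivializationAt E (TangentSpace 𝓘(ℝ, E)) (γ t₀) (A.lift (t, v))).2 := by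
  simp only [localFrame, ContinuousLinearMap.comp_apply, lift]
  rw [Bundle.Trivialization.continuousLinearMapAt_apply,
    Bundle.Trivialization.coe_linearMapAt_of_mem _ h]
  rfl

theorem eventually_mem_baseSet (γ : C(I, M)) (t₀ : I) :
    ∀ᶠ t in 𝓝 t₀, γ t ∈ (trivializationAt E (TangentSpace 𝓘(ℝ, E)) (γ t₀)).baseSet :=
  γ.continuous.continuousAt.eventually
    ((trivializationAt E (TangentSpace 𝓘(ℝ, E)) (γ t₀)).open_baseSet.mem_nhds
      (FiberBundle.mem_baseSet_trivializationAt' _))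

variable [FiniteDimensional ℝ E]

/-- In finite dimension continuity in operator norm can be tested on each vector, where it follows
from continuity of the frame. -/
theorem continuousAt_localFrame {t₀ t : I}
    (h : γ t ∈ (trivializationAt E (TangentSpace 𝓘(ℝ, E)) (γ t₀)).baseSet) :
    ContinuousAt (A.localFrame t₀) t := by
  set e := trivializationAt E (TangentSpace 𝓘(ℝ, E)) (γ t₀)
  have ho : IsOpen (γ ⁻¹' e.baseSet) := e.open_baseSet.preimage γ.continuous
  refine ContinuousOn.continuousAt (s := γ ⁻¹' e.baseSet) ?_ (ho.mem_nhds h)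
  rw [continuousOn_clm_apply]
  intro v
  have h1 : ContinuousOn (fun t => (e (A.lift (t, v))).2) (γ ⁻¹' e.baseSet) := by
    refine continuous_snd.comp_continuousOn (e.continuousOn.comp
      (A.continuous_lift.comp (by fun_prop)).continuousOn ?_)
    intro s hs
    exact e.mem_source.2 hs
  exact h1.congr fun s hs => A.localFrame_apply hs v

omit [FiniteDimensional ℝ E] in
theorem localFrame_eq_equiv {t₀ t : I}
    (h : γ t ∈ (trivializationAt E (TangentSpace 𝓘(ℝ, E)) (γ t₀)).baseSet) :
    ∃ L : E ≃L[ℝ] E, A.localFrame t₀ t = L ∧ ∀ ξ : TangentBundle 𝓘(ℝ, E) M, ξ.proj = γ t →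
      A.coord t ξ = L.symm (trivializationAt E (TangentSpace 𝓘(ℝ, E)) (γ t₀) ξ).2 := by
  set e := trivializationAt E (TangentSpace 𝓘(ℝ, E)) (γ t₀)
  let L : E ≃L[ℝ] E := (A.equiv t).trans (e.continuousLinearEquivAt ℝ (γ t) h)
  have hL : A.localFrame t₀ t = L := by
    ext v
    simp only [localFrame, L, ContinuousLinearMap.comp_apply, ContinuousLinearEquiv.coe_coe]
    rw [ContinuousLinearEquiv.trans_apply,
      ← Bundle.Trivialization.coe_continuousLinearEquivAt_eq e h]
  refine ⟨L, hL, fun ξ hξ => ?_⟩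
  rw [ContinuousLinearEquiv.eq_symm_apply]
  have h1 := A.localFrame_apply h (A.coord t ξ)
  rw [A.lift_coord hξ, hL] at h1
  exact h1

theorem continuousAt_inverse_localFrame {t₀ t : I}
    (h : γ t ∈ (trivializationAt E (TangentSpace 𝓘(ℝ, E)) (γ t₀)).baseSet) :
    ContinuousAt (fun t => ContinuousLinearMap.inverse (A.localFrame t₀ t)) t := by
  have h1 := A.continuousAt_localFrame h
  obtain ⟨L, hL, -⟩ := A.localFrame_eq_equiv h
  have h2 : ContinuousAt ContinuousLinearMap.inverse (A.localFrame t₀ t) := by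
    rw [hL]
    have : CompleteSpace E := FiniteDimensional.complete ℝ E
    exact (contDiffAt_map_inverse (𝕜 := ℝ) (n := 0) L).continuousAt
  exact ContinuousAt.comp (g := ContinuousLinearMap.inverse) h2 h1

omit [FiniteDimensional ℝ E] in
theorem coord_eq {t₀ t : I}
    (h : γ t ∈ (trivializationAt E (TangentSpace 𝓘(ℝ, E)) (γ t₀)).baseSet)
    {ξ : TangentBundle 𝓘(ℝ, E) M} (hξ : ξ.proj = γ t) :
    A.coord t ξ = ContinuousLinearMap.inverse (A.localFrame t₀ t)
      (trivializationAt E (TangentSpace 𝓘(ℝ, E)) (γ t₀) ξ).2 := by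
  obtain ⟨L, hL, h2⟩ := A.localFrame_eq_equiv h
  rw [hL, ContinuousLinearMap.inverse_equiv, h2 ξ hξ]
  rfl

/-- In a chart of `TM` around `γ z.1` the lift is `(x (γ t), L_t v)`, where `x` is the chart of `M`
and `L_t` the local frame. The continuous parameters are `x (γ t)` and `L_t`; the dependence on them
and on `v` is smooth. -/
theorem paramSmoothAt_lift (z : I × E) : ParamSmoothAt 𝓘(ℝ, E).tangent A.lift z := by
  set x₀ : M := γ z.1
  let ψ := extChartAt 𝓘(ℝ, E).tangent (⟨x₀, 0⟩ : TangentBundle 𝓘(ℝ, E) M)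
  have hb := eventually_mem_baseSet (E := E) γ z.1
  have h1 : ParamSmoothAt (E := E) 𝓘(ℝ, E) (fun w : I × E => extChartAt 𝓘(ℝ, E) x₀ (γ w.1)) z := by
    refine ParamSmoothAt.of_continuousAt (c := fun t => extChartAt 𝓘(ℝ, E) x₀ (γ t)) ?_
    filter_upwards [hb] with t ht
    refine ContinuousAt.comp (g := extChartAt 𝓘(ℝ, E) x₀) ?_ γ.continuous.continuousAt
    refine continuousAt_extChartAt' ?_
    rwa [extChartAt_source]
  have h2 : ParamSmoothAt (E := E) 𝓘(ℝ, E) (fun w : I × E => A.localFrame z.1 w.1 w.2) z :=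
    ParamSmoothAt.clm_apply
      (ParamSmoothAt.of_continuousAt (hb.mono fun t ht => A.continuousAt_localFrame ht))
      (ParamSmoothAt.snd z)
  have h3 : ∀ᶠ w : I × E in 𝓝 z, A.lift w ∈ ψ.source ∧
      ψ (A.lift w) = (extChartAt 𝓘(ℝ, E) x₀ (γ w.1), A.localFrame z.1 w.1 w.2) := by
    filter_upwards [continuousAt_fst.eventually hb] with w hw
    constructor
    · rw [extChartAt_source, TangentBundle.mem_chart_source_iff]
      exact hw
    · rw [A.localFrame_apply hw]
      simp only [ψ, FiberBundle.extChartAt]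
      rfl
  have h4 := h3.self_of_nhds
  have h5 := (h1.prodMk_space h2).comp (J' := 𝓘(ℝ, E).tangent) (f := ψ.symm) ?_
  · refine h5.congr ?_
    filter_upwards [h3] with w hw
    rw [← hw.2, ψ.left_inv hw.1]
  · have h6 : ψ.target ∈ 𝓝 (extChartAt 𝓘(ℝ, E) x₀ (γ z.1), A.localFrame z.1 z.1 z.2) := by
      rw [← h4.2]
      exact (isOpen_extChartAt_target _).mem_nhds (ψ.map_source h4.1)
    filter_upwards [eventually_mem_nhds_iff.2 h6] with y hy
    exact (contMDiffOn_extChartAt_symm (n := ∞)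
      (⟨x₀, 0⟩ : TangentBundle 𝓘(ℝ, E) M)).contMDiffAt hy

/-- Coordinates are obtained by applying the inverse of the local frame, a continuous
operator-valued parameter, to the fibre component in a trivialisation. -/
theorem paramSmoothAt_coord {Ξ : I × E → TangentBundle 𝓘(ℝ, E) M} {z : I × E}
    (hΞ : ParamSmoothAt 𝓘(ℝ, E).tangent Ξ z) (h : ∀ᶠ w in 𝓝 z, (Ξ w).proj = γ w.1) :
    ParamSmoothAt 𝓘(ℝ, E) (fun w => A.coord w.1 (Ξ w)) z := by
  have hb := eventually_mem_baseSet (E := E) γ z.1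
  set e := trivializationAt E (TangentSpace 𝓘(ℝ, E)) (γ z.1) with he
  have h2 : ParamSmoothAt (E := E) 𝓘(ℝ, E)
      (fun w : I × E => ContinuousLinearMap.inverse (A.localFrame z.1 w.1) (e (Ξ w)).2) z := by
    refine ParamSmoothAt.clm_apply
      (ParamSmoothAt.of_continuousAt (c := fun t => ContinuousLinearMap.inverse (A.localFrame z.1 t))
        (hb.mono fun t ht => A.continuousAt_inverse_localFrame ht))
      (hΞ.comp (f := fun ξ => (e ξ).2) ?_)
    have hs : e.source ∈ 𝓝 (Ξ z) := e.open_source.mem_nhds (by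
      rw [e.mem_source, h.self_of_nhds]
      exact hb.self_of_nhds)
    filter_upwards [eventually_mem_nhds_iff.2 hs] with ξ hξ
    have h3 : ContMDiffAt 𝓘(ℝ, E).tangent (𝓘(ℝ, E).prod 𝓘(ℝ, E)) ∞ e ξ :=
      (Bundle.Trivialization.contMDiffOn (IB := 𝓘(ℝ, E)) e).contMDiffAt hξ
    exact contMDiffAt_snd.comp ξ h3
  refine h2.congr ?_
  filter_upwards [h, continuousAt_fst.eventually hb] with w h3 h4
  exact A.coord_eq h4 h3

end FrameAlong

/-! ### Path charts -/

variable {γ γ' : C(I, M)} [FiniteDimensional ℝ E]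

/-- The map `(t, v) ↦ α (A_t v)`. -/
noncomputable def LocalAddition.kernel (α : LocalAddition E M) (A : FrameAlong E M γ) (w : I × E) : M :=
  (α.toHomeo (A.lift w)).2

/-- The fibrewise inverse of `LocalAddition.kernel`. -/
noncomputable def LocalAddition.kernelInv (α : LocalAddition E M) (A : FrameAlong E M γ) (w : I × M) : E :=
  A.coord w.1 (α.toHomeo.symm (γ w.1, w.2))

namespace LocalAddition

variable (α : LocalAddition E M) (A : FrameAlong E M γ)

omit [FiniteDimensional ℝ E] in
theorem toHomeo_lift {w : I × E} (h : A.lift w ∈ α.toHomeo.source) :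
    α.toHomeo (A.lift w) = (γ w.1, α.kernel A w) :=
  Prod.ext (α.fst_eq _ h) rfl

omit [FiniteDimensional ℝ E] in
theorem kernel_mem_target {w : I × E} (h : A.lift w ∈ α.toHomeo.source) :
    (γ w.1, α.kernel A w) ∈ α.toHomeo.target := by
  rw [← α.toHomeo_lift A h]
  exact α.toHomeo.map_source h

omit [FiniteDimensional ℝ E] in
theorem kernelInv_kernel {w : I × E} (h : A.lift w ∈ α.toHomeo.source) :
    α.kernelInv A (w.1, α.kernel A w) = w.2 := by
  simp only [kernelInv]
  rw [← α.toHomeo_lift A h, α.toHomeo.left_inv h, A.coord_lift]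

omit [FiniteDimensional ℝ E] in
theorem proj_symm {p : M × M} (h : p ∈ α.toHomeo.target) : (α.toHomeo.symm p).proj = p.1 := by
  rw [← α.fst_eq _ (α.toHomeo.map_target h), α.toHomeo.right_inv h]

omit [FiniteDimensional ℝ E] in
theorem lift_kernelInv {t : I} {y : M} (h : (γ t, y) ∈ α.toHomeo.target) :
    A.lift (t, α.kernelInv A (t, y)) = α.toHomeo.symm (γ t, y) :=
  A.lift_coord (α.proj_symm h)

omit [FiniteDimensional ℝ E] in
theorem lift_kernelInv_mem {t : I} {y : M} (h : (γ t, y) ∈ α.toHomeo.target) :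
    A.lift (t, α.kernelInv A (t, y)) ∈ α.toHomeo.source := by
  rw [α.lift_kernelInv A h]
  exact α.toHomeo.map_target h

omit [FiniteDimensional ℝ E] in
theorem kernel_kernelInv {t : I} {y : M} (h : (γ t, y) ∈ α.toHomeo.target) :
    α.kernel A (t, α.kernelInv A (t, y)) = y := by
  simp only [kernel]
  rw [α.lift_kernelInv A h, α.toHomeo.right_inv h]

theorem paramSmoothAt_kernel {z : I × E} (h : A.lift z ∈ α.toHomeo.source) :
    ParamSmoothAt 𝓘(ℝ, E) (α.kernel A) z := by
  refine (A.paramSmoothAt_lift z).comp (f := fun ξ => (α.toHomeo ξ).2) ?_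
  filter_upwards [eventually_mem_nhds_iff.2 (α.toHomeo.open_source.mem_nhds h)] with ξ hξ
  exact contMDiffAt_snd.comp ξ (α.smooth.contMDiffAt hξ)

/-- Stated after composition with `g` because the second variable in `ParamSmoothAt` is a vector,
not a point of `M`. -/
theorem paramSmoothAt_kernelInv {g : I × E → M} {z : I × E}
    (hg : ParamSmoothAt 𝓘(ℝ, E) g z) (h : (γ z.1, g z) ∈ α.toHomeo.target) :
    ParamSmoothAt 𝓘(ℝ, E) (fun w => α.kernelInv A (w.1, g w)) z := by
  have h0 : ParamSmoothAt (E := E) 𝓘(ℝ, E) (fun w : I × E => γ w.1) z :=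
    (A.paramSmoothAt_lift z).comp (f := fun ξ => ξ.proj)
      (.of_forall fun ξ => (Bundle.contMDiff_proj (TangentSpace 𝓘(ℝ, E))).contMDiffAt)
  have hn := α.toHomeo.open_target.mem_nhds h
  have h1 := h0.prodMk hg
  refine A.paramSmoothAt_coord (h1.comp (f := α.toHomeo.symm) ?_) ?_
  · filter_upwards [eventually_mem_nhds_iff.2 hn] with p hp
    exact α.smooth_symm.contMDiffAt hp
  · filter_upwards [h1.continuousAt.eventually hn] with w hw
    exact α.proj_symm hw

end LocalAddition

/-- `e` is the chart of `C(I, M)` given by the local addition `α` and the frame `A` along `γ`. -/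
structure IsPathChartOf (α : LocalAddition E M) (A : FrameAlong E M γ)
    (e : OpenPartialHomeomorph C(I, M) C(I, E)) : Prop where
  target_eq : e.target = {f | ∀ t, A.lift (t, f t) ∈ α.toHomeo.source}
  symm_apply : ∀ f ∈ e.target, ∀ t, e.symm f t = α.kernel A (t, f t)

omit [FiniteDimensional ℝ E] in
theorem IsPathChart.exists_isPathChartOf {e : OpenPartialHomeomorph C(I, M) C(I, E)}
    (h : IsPathChart E M e) : ∃ (γ : C(I, M)) (α : LocalAddition E M) (A : FrameAlong E M γ),
      IsPathChartOf α A e := by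
  obtain ⟨α, γ, A, -, h1, h2⟩ := h
  exact ⟨γ, α, A, h1, h2⟩

namespace IsPathChartOf

variable {α α' : LocalAddition E M} {A : FrameAlong E M γ} {A' : FrameAlong E M γ'}
  {e e' : OpenPartialHomeomorph C(I, M) C(I, E)}

omit [FiniteDimensional ℝ E] in
theorem lift_mem (h : IsPathChartOf α A e) {f : C(I, E)} (hf : f ∈ e.target) (t : I) :
    A.lift (t, f t) ∈ α.toHomeo.source := by
  rw [h.target_eq] at hf
  exact hf t

omit [FiniteDimensional ℝ E] in
theorem apply_eq (h : IsPathChartOf α A e) {η : C(I, M)} (hη : η ∈ e.source) (t : I) :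
    e η t = α.kernelInv A (t, η t) := by
  have h1 := e.map_source hη
  have h2 := h.symm_apply _ h1 t
  rw [e.left_inv hη] at h2
  rw [h2, α.kernelInv_kernel A (h.lift_mem h1 t)]

omit [FiniteDimensional ℝ E] in
theorem mem_target (h : IsPathChartOf α A e) {η : C(I, M)} (hη : η ∈ e.source) (t : I) :
    (γ t, η t) ∈ α.toHomeo.target := by
  have h1 := e.map_source hη
  have h2 := h.symm_apply _ h1 t
  rw [e.left_inv hη] at h2
  rw [h2]
  exact α.kernel_mem_target A (h.lift_mem h1 t)

/-- The transition acts pointwise in `t`, by one kernel followed by the other fibrewise inverse, so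
the omega lemma applies. -/
theorem contDiffOn_transition (h : IsPathChartOf α A e) (h' : IsPathChartOf α' A' e') :
    ContDiffOn ℝ ∞ (e' ∘ e.symm) (e.symm.trans e').source := by
  intro f₀ hf₀
  refine ContDiffAt.contDiffWithinAt ?_
  refine contDiffAt_superposition
    (g := fun w : I × E => α'.kernelInv A' (w.1, α.kernel A w)) (fun t => ?_) ?_
  · have h1 : f₀ ∈ e.target := hf₀.1
    have h2 : e.symm f₀ ∈ e'.source := hf₀.2
    refine α'.paramSmoothAt_kernelInv A' (α.paramSmoothAt_kernel A (h.lift_mem h1 t)) ?_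
    rw [← h.symm_apply f₀ h1]
    exact h'.mem_target h2 t
  · filter_upwards [(e.symm.trans e').open_source.mem_nhds hf₀] with f hf t
    have h1 : f ∈ e.target := hf.1
    have h2 : e.symm f ∈ e'.source := hf.2
    rw [Function.comp_apply, h'.apply_eq h2, h.symm_apply f h1]

end IsPathChartOf

end Frames

section PathCharts

/-! ### Existence of frames -/

variable {E : Type v} [NormedAddCommGroup E] [NormedSpace ℝ E]
  {M : Type u} [TopologicalSpace M] [ChartedSpace E M] [IsManifold 𝓘(ℝ, E) ∞ M]

open Classical in
/-- A frame along `γ` that is constant in the trivialisation around `x`, while this makes sense. -/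
noncomputable def constFrame (γ : I → M) (x : M) (L : E ≃L[ℝ] E) (s : I) :
    E ≃L[ℝ] TangentSpace 𝓘(ℝ, E) (γ s) :=
  if h : γ s ∈ (trivializationAt E (TangentSpace 𝓘(ℝ, E)) x).baseSet then
    L.trans ((trivializationAt E (TangentSpace 𝓘(ℝ, E)) x).continuousLinearEquivAt ℝ (γ s) h).symm
  else ContinuousLinearEquiv.refl ℝ E

theorem constFrame_apply (γ : I → M) (x : M) (L : E ≃L[ℝ] E) {s : I}
    (h : γ s ∈ (trivializationAt E (TangentSpace 𝓘(ℝ, E)) x).baseSet) (v : E) :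
    constFrame γ x L s v = ((trivializationAt E (TangentSpace 𝓘(ℝ, E)) x).continuousLinearEquivAt ℝ
      (γ s) h).symm (L v) := by
  have h1 : constFrame γ x L s = L.trans
      ((trivializationAt E (TangentSpace 𝓘(ℝ, E)) x).continuousLinearEquivAt ℝ (γ s) h).symm :=
    dif_pos h
  rw [h1]
  rfl

theorem continuousOn_constFrame (γ : C(I, M)) (x : M) (L : E ≃L[ℝ] E) {S : Set I}
    (hS : S ⊆ γ ⁻¹' (trivializationAt E (TangentSpace 𝓘(ℝ, E)) x).baseSet) :
    ContinuousOn (fun p : I × E =>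
      (⟨γ p.1, constFrame γ x L p.1 p.2⟩ : TangentBundle 𝓘(ℝ, E) M)) (S ×ˢ Set.univ) := by
  set e := trivializationAt E (TangentSpace 𝓘(ℝ, E)) x
  have h1 : ContinuousOn (fun p : I × E => e.toOpenPartialHomeomorph.symm (γ p.1, L p.2))
      (S ×ˢ Set.univ) := by
    refine e.toOpenPartialHomeomorph.continuousOn_symm.comp (by fun_prop) ?_
    rintro ⟨s, v⟩ hs
    exact e.mem_target.2 (hS hs.1)
  refine h1.congr ?_
  rintro ⟨s, v⟩ hs
  have hs' : γ s ∈ e.baseSet := hS hs.1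
  refine (congrArg (Bundle.TotalSpace.mk (γ s)) (constFrame_apply γ x L hs' v)).trans ?_
  exact e.mk_symm hs' (L v)

/-- Every path admits a continuous frame. -/
theorem nonempty_frameAlong (γ : C(I, M)) : Nonempty (FrameAlong E M γ) := by
  -- Subdivide `I` so that each piece of `γ` lies in one trivialisation, then extend the frame piece
  -- by piece.
  obtain ⟨t, ht0, hmono, ⟨n, hn⟩, hcov⟩ := exists_monotone_Icc_subset_open_cover_unitInterval
    (c := fun x : M => γ ⁻¹' (trivializationAt E (TangentSpace 𝓘(ℝ, E)) x).baseSet)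
    (fun x => (trivializationAt E (TangentSpace 𝓘(ℝ, E)) x).open_baseSet.preimage γ.continuous)
    (fun s _ => Set.mem_iUnion.2 ⟨γ s,
      FiberBundle.mem_baseSet_trivializationAt E (TangentSpace 𝓘(ℝ, E)) (γ s)⟩)
  have claim : ∀ k, ∃ A : ∀ s : I, E ≃L[ℝ] TangentSpace 𝓘(ℝ, E) (γ s),
      ContinuousOn (fun p : I × E => (⟨γ p.1, A p.1 p.2⟩ : TangentBundle 𝓘(ℝ, E) M))
        (Set.Iic (t k) ×ˢ Set.univ) := by
    intro k
    induction k with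
    | zero =>
      refine ⟨constFrame γ (γ 0) (ContinuousLinearEquiv.refl ℝ E),
        continuousOn_constFrame γ _ _ ?_⟩
      intro s hs
      change γ s ∈ (trivializationAt E (TangentSpace 𝓘(ℝ, E)) (γ 0)).baseSet
      have h0 : s = 0 := le_antisymm (by simpa [ht0] using hs) bot_le
      rw [h0]
      exact FiberBundle.mem_baseSet_trivializationAt E (TangentSpace 𝓘(ℝ, E)) (γ 0)
    | succ k ih =>
      obtain ⟨A, hA⟩ := ih
      obtain ⟨x, hx⟩ := hcov k
      set e := trivializationAt E (TangentSpace 𝓘(ℝ, E)) x with he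
      have hk : γ (t k) ∈ e.baseSet := hx ⟨le_rfl, hmono (Nat.le_succ k)⟩
      -- `L` is the old frame at `t k` read in the new trivialisation, so that the two frames agree
      -- where they are glued.
      let L : E ≃L[ℝ] E := (A (t k)).trans (e.continuousLinearEquivAt ℝ (γ (t k)) hk)
      classical
      let A' : ∀ s : I, E ≃L[ℝ] TangentSpace 𝓘(ℝ, E) (γ s) := fun s =>
        if s ≤ t k then A s else constFrame γ x L s
      refine ⟨A', ?_⟩
      have hU : Set.Iic (t (k + 1)) ×ˢ (Set.univ : Set E) =
          Set.Iic (t k) ×ˢ Set.univ ∪ Set.Icc (t k) (t (k + 1)) ×ˢ Set.univ := by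
        rw [← Set.union_prod, Set.Iic_union_Icc_eq_Iic (hmono (Nat.le_succ k))]
      rw [hU]
      refine ContinuousOn.union_of_isClosed ?_ ?_ (isClosed_Iic.prod isClosed_univ)
        (isClosed_Icc.prod isClosed_univ)
      · refine hA.congr ?_
        rintro ⟨s, v⟩ hs
        have hs' : s ≤ t k := hs.1
        simp only [A', if_pos hs']
      · refine (continuousOn_constFrame γ x L hx).congr ?_
        rintro ⟨s, v⟩ hs
        have hs' : t k ≤ s := hs.1.1
        rcases hs'.eq_or_lt with h | h
        · subst h
          simp only [A', if_pos le_rfl]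
          refine congrArg (Bundle.TotalSpace.mk (γ (t k))) ?_
          rw [constFrame_apply γ x L hk]
          exact ((e.continuousLinearEquivAt ℝ (γ (t k)) hk).symm_apply_apply (A (t k) v)).symm
        · simp only [A', if_neg (not_le.2 h)]
  obtain ⟨A, hA⟩ := claim n
  refine ⟨⟨A, ?_⟩⟩
  rw [hn n le_rfl] at hA
  rw [← continuousOn_univ]
  refine hA.mono fun p _ => ⟨unitInterval.le_one', trivial⟩

/-! ### Existence of path charts -/

theorem isOpen_forall_graph {Y : Type*} [TopologicalSpace Y] {W : Set (I × Y)} (hW : IsOpen W) :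
    IsOpen {f : C(I, Y) | ∀ t, (t, f t) ∈ W} := by
  rw [isOpen_iff_mem_nhds]
  intro f hf
  have := isCompact_univ.eventually_forall_of_forall_eventually (x₀ := f)
    (P := fun (f : C(I, Y)) t => (t, f t) ∈ W) (K := Set.univ) (fun t _ =>
      (by fun_prop : Continuous fun p : C(I, Y) × I => (p.2, p.1 p.2)).continuousAt.eventually
        (hW.mem_nhds (hf t)))
  exact this.mono fun f hf t => hf t trivial

theorem continuousOn_superposition {Y Z : Type*} [TopologicalSpace Y] [TopologicalSpace Z]
    {g : I × Y → Z} {S : C(I, Y) → C(I, Z)} {U : Set C(I, Y)}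
    (hg : ∀ f ∈ U, ∀ t, ContinuousAt g (t, f t)) (hS : ∀ f ∈ U, ∀ t, S f t = g (t, f t)) :
    ContinuousOn S U := by
  rw [continuousOn_iff_continuous_domRestrict]
  refine ContinuousMap.continuous_of_continuous_uncurry _ ?_
  rw [continuous_iff_continuousAt]
  rintro ⟨⟨f, hf⟩, t⟩
  have h1 : ContinuousAt (fun p : U × I => g (p.2, p.1.1 p.2)) (⟨f, hf⟩, t) :=
    ContinuousAt.comp (g := g) (hg f hf t)
      (by fun_prop : Continuous fun p : U × I => (p.2, p.1.1 p.2)).continuousAt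
  refine h1.congr (.of_forall fun p => ?_)
  exact (hS p.1.1 p.1.2 p.2).symm

variable {γ : C(I, M)} [FiniteDimensional ℝ E]

theorem FrameAlong.continuousAt_coord (A : FrameAlong E M γ) {X : Type*} [TopologicalSpace X]
    {τ : X → I} {Ξ : X → TangentBundle 𝓘(ℝ, E) M} {x : X} (hτ : ContinuousAt τ x)
    (hΞ : ContinuousAt Ξ x) (h : ∀ᶠ y in 𝓝 x, (Ξ y).proj = γ (τ y)) :
    ContinuousAt (fun y => A.coord (τ y) (Ξ y)) x := by
  have hb := eventually_mem_baseSet (E := E) γ (τ x)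
  set e := trivializationAt E (TangentSpace 𝓘(ℝ, E)) (γ (τ x))
  have hs : Ξ x ∈ e.source := by
    rw [e.mem_source, h.self_of_nhds]
    exact hb.self_of_nhds
  have h1 : ContinuousAt (fun y => (e (Ξ y)).2) x :=
    continuousAt_snd.comp (ContinuousAt.comp (g := e) (e.continuousAt hs) hΞ)
  have h2 := ContinuousAt.comp (g := fun t => ContinuousLinearMap.inverse (A.localFrame (τ x) t))
    (A.continuousAt_inverse_localFrame hb.self_of_nhds) hτ
  refine (h2.clm_apply h1).congr ?_
  filter_upwards [h, hτ.eventually hb] with y h3 h4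
  exact (A.coord_eq h4 h3).symm

theorem LocalAddition.continuousAt_kernelInv (α : LocalAddition E M) (A : FrameAlong E M γ)
    {w : I × M} (h : (γ w.1, w.2) ∈ α.toHomeo.target) : ContinuousAt (α.kernelInv A) w := by
  have hn := α.toHomeo.open_target.mem_nhds h
  have hc : ContinuousAt (fun w : I × M => (γ w.1, w.2)) w :=
    (by fun_prop : Continuous fun w : I × M => (γ w.1, w.2)).continuousAt
  refine A.continuousAt_coord (τ := Prod.fst) (Ξ := fun w => α.toHomeo.symm (γ w.1, w.2))
    continuousAt_fst ?_ ?_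
  · exact ContinuousAt.comp (g := α.toHomeo.symm) (α.toHomeo.continuousAt_symm h) hc
  · filter_upwards [hc.eventually hn] with w' hw'
    exact α.proj_symm hw'

omit [FiniteDimensional ℝ E] in
theorem LocalAddition.continuousAt_kernel (α : LocalAddition E M) (A : FrameAlong E M γ)
    {w : I × E} (h : A.lift w ∈ α.toHomeo.source) : ContinuousAt (α.kernel A) w :=
  continuousAt_snd.comp (ContinuousAt.comp (g := α.toHomeo) (α.toHomeo.continuousAt h)
    A.continuous_lift.continuousAt)

omit [FiniteDimensional ℝ E] in
theorem LocalAddition.apply_kernel_mkD' (α : LocalAddition E M) (A : FrameAlong E M γ)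
    {f : C(I, E)} (hf : ∀ t, A.lift (t, f t) ∈ α.toHomeo.source) (t : I) :
    ContinuousMap.mkD' (fun t => α.kernel A (t, f t)) γ t = α.kernel A (t, f t) :=
  ContinuousMap.mkD'_apply (g := fun t => α.kernel A (t, f t))
    (continuous_graph_comp (g := α.kernel A) fun t => α.continuousAt_kernel A (hf t)) t

theorem LocalAddition.apply_kernelInv_mkD' (α : LocalAddition E M) (A : FrameAlong E M γ)
    {η : C(I, M)} (hη : ∀ t, (γ t, η t) ∈ α.toHomeo.target) (t : I) :
    ContinuousMap.mkD' (fun t => α.kernelInv A (t, η t)) 0 t = α.kernelInv A (t, η t) := by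
  refine ContinuousMap.mkD'_apply (g := fun t => α.kernelInv A (t, η t)) ?_ t
  rw [continuous_iff_continuousAt]
  intro t
  exact ContinuousAt.comp (g := α.kernelInv A) (α.continuousAt_kernelInv A (hη t))
    (by fun_prop : Continuous fun t => (t, η t)).continuousAt

/-- The chart of `C(I, M)` given by a local addition and a frame. -/
noncomputable def LocalAddition.pathChart (α : LocalAddition E M) (A : FrameAlong E M γ) :
    OpenPartialHomeomorph C(I, M) C(I, E) where
  toFun η := ContinuousMap.mkD' (fun t => α.kernelInv A (t, η t)) 0
  invFun f := ContinuousMap.mkD' (fun t => α.kernel A (t, f t)) γ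
  source := {η | ∀ t, (γ t, η t) ∈ α.toHomeo.target}
  target := {f | ∀ t, A.lift (t, f t) ∈ α.toHomeo.source}
  map_source' η hη t := by
    rw [α.apply_kernelInv_mkD' A hη]
    exact α.lift_kernelInv_mem A (hη t)
  map_target' f hf t := by
    rw [α.apply_kernel_mkD' A hf]
    exact α.kernel_mem_target A (hf t)
  left_inv' η hη := by
    ext t
    rw [α.apply_kernel_mkD' A, α.apply_kernelInv_mkD' A hη, α.kernel_kernelInv A (hη t)]
    intro t
    rw [α.apply_kernelInv_mkD' A hη]
    exact α.lift_kernelInv_mem A (hη t)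
  right_inv' f hf := by
    ext t
    rw [α.apply_kernelInv_mkD' A, α.apply_kernel_mkD' A hf, α.kernelInv_kernel A (hf t)]
    intro t
    rw [α.apply_kernel_mkD' A hf]
    exact α.kernel_mem_target A (hf t)
  open_source := isOpen_forall_graph (W := {w : I × M | (γ w.1, w.2) ∈ α.toHomeo.target})
    (α.toHomeo.open_target.preimage (by fun_prop))
  open_target := isOpen_forall_graph (α.toHomeo.open_source.preimage A.continuous_lift)
  continuousOn_toFun := continuousOn_superposition (g := α.kernelInv A)
    (fun η hη t => α.continuousAt_kernelInv A (hη t)) fun η hη t => α.apply_kernelInv_mkD' A hη t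
  continuousOn_invFun := continuousOn_superposition (g := α.kernel A)
    (fun f hf t => α.continuousAt_kernel A (hf t)) fun f hf t => α.apply_kernel_mkD' A hf t

theorem LocalAddition.exists_isPathChart (α : LocalAddition E M)
    (h : ∀ t, (⟨γ t, 0⟩ : TangentBundle 𝓘(ℝ, E) M) ∈ α.toHomeo.source) :
    ∃ e, IsPathChart E M e ∧ γ ∈ e.source := by
  obtain ⟨A⟩ := nonempty_frameAlong (E := E) γ
  refine ⟨α.pathChart A, ⟨α, γ, A, h, rfl, fun f hf t => α.apply_kernel_mkD' A hf t⟩, fun t => ?_⟩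
  rw [← α.map_zero _ (h t)]
  exact α.toHomeo.map_source (h t)

end PathCharts

/-! ### The inverse function theorem on manifolds -/

section InverseFunction

variable {E₁ : Type*} [NormedAddCommGroup E₁] [NormedSpace ℝ E₁]
  {H : Type*} [TopologicalSpace H] {I₁ : ModelWithCorners ℝ E₁ H} [I₁.Boundaryless]
  {X : Type*} [TopologicalSpace X] [ChartedSpace H X] [IsManifold I₁ ∞ X]
  {H' : Type*} [TopologicalSpace H'] {J₁ : ModelWithCorners ℝ E₁ H'} [J₁.Boundaryless]
  {Y : Type*} [TopologicalSpace Y] [ChartedSpace H' Y] [IsManifold J₁ ∞ Y]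

/-- An extended chart of a manifold without boundary, as a partial diffeomorphism. -/
noncomputable def extChartPartialDiffeomorph (I₁ : ModelWithCorners ℝ E₁ H) [I₁.Boundaryless]
    {X : Type*} [TopologicalSpace X] [ChartedSpace H X] [IsManifold I₁ ∞ X] (x : X) :
    PartialDiffeomorph I₁ 𝓘(ℝ, E₁) X E₁ ∞ where
  toPartialEquiv := extChartAt I₁ x
  open_source := isOpen_extChartAt_source x
  open_target := isOpen_extChartAt_target x
  contMDiffOn_toFun := by
    have : ContMDiffOn I₁ 𝓘(ℝ, E₁) ∞ (extChartAt I₁ x) (chartAt H x).source :=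
      contMDiffOn_extChartAt
    rwa [← extChartAt_source I₁] at this
  contMDiffOn_invFun := contMDiffOn_extChartAt_symm x

variable [FiniteDimensional ℝ E₁]

/-- A smooth map between open subsets of `E₁` with invertible derivative at `a` is a local
diffeomorphism at `a`. -/
theorem isLocalDiffeomorphAt_of_injective_fderiv {g : E₁ → E₁} {a : E₁}
    (hg : ∀ᶠ y in 𝓝 a, ContDiffAt ℝ ∞ g y) (hinj : Function.Injective (fderiv ℝ g a)) :
    IsLocalDiffeomorphAt 𝓘(ℝ, E₁) 𝓘(ℝ, E₁) ∞ g a := by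
  have : CompleteSpace E₁ := FiniteDimensional.complete ℝ E₁
  have hga := hg.self_of_nhds
  let L : E₁ ≃L[ℝ] E₁ :=
    (LinearEquiv.ofInjectiveEndo (fderiv ℝ g a : E₁ →ₗ[ℝ] E₁) hinj).toContinuousLinearEquiv
  have hL : (L : E₁ →L[ℝ] E₁) = fderiv ℝ g a := by ext v; rfl
  have hd : HasFDerivAt g (L : E₁ →L[ℝ] E₁) a := by
    rw [hL]; exact (hga.differentiableAt (by simp)).hasFDerivAt
  let Ψ := hga.toOpenPartialHomeomorph g hd (by simp)
  have hc : ContinuousAt (fderiv ℝ g) a :=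
    (hga.fderiv_right (m := ∞) (by simp)).continuousAt
  -- Invertibility of the derivative is an open condition. Shrinking to where it holds gives
  -- smoothness of the inverse on its whole domain, not only at the image of `a`.
  have hev : ∀ᶠ y in 𝓝 a, ContDiffAt ℝ ∞ g y ∧
      fderiv ℝ g y ∈ Set.range ((↑) : (E₁ ≃L[ℝ] E₁) → (E₁ →L[ℝ] E₁)) := by
    refine hg.and (hc.eventually (ContinuousLinearEquiv.isOpen.mem_nhds ⟨L, hL⟩))
  obtain ⟨S, hS, hSo, haS⟩ := eventually_nhds_iff.1 hev
  let Φ := Ψ.restrOpen S hSo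
  have hΦs : Φ.source = Ψ.source ∩ S := rfl
  refine ⟨⟨Φ.toPartialEquiv, Φ.open_source, Φ.open_target, ?_, ?_⟩,
    ⟨hga.mem_toOpenPartialHomeomorph_source hd (by simp), haS⟩, fun y _ => rfl⟩
  · intro y hy
    exact ((hS y hy.2).1.contMDiffAt).contMDiffWithinAt
  · intro y hy
    have h1 : Φ.symm y ∈ Φ.source := Φ.map_target hy
    obtain ⟨h2, L', hL'⟩ := hS _ h1.2
    have h3 : HasFDerivAt Φ (L' : E₁ →L[ℝ] E₁) (Φ.symm y) := by
      rw [hL']; exact (h2.differentiableAt (by simp)).hasFDerivAt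
    exact (Φ.contDiffAt_symm hy h3 h2).contMDiffAt.contMDiffWithinAt

omit [I₁.Boundaryless] [J₁.Boundaryless] [IsManifold I₁ ∞ X] [IsManifold J₁ ∞ Y]
  [FiniteDimensional ℝ E₁] in
theorem IsLocalDiffeomorphAt.congr_of_eventuallyEq {f g : X → Y} {x : X}
    (hf : IsLocalDiffeomorphAt I₁ J₁ ∞ f x) (h : g =ᶠ[𝓝 x] f) :
    IsLocalDiffeomorphAt I₁ J₁ ∞ g x := by
  obtain ⟨Φ, hx, hΦ⟩ := hf
  obtain ⟨S, hS, hSo, hxS⟩ := eventually_nhds_iff.1 h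
  let Φ' := Φ.toOpenPartialHomeomorph.restrOpen S hSo
  refine ⟨⟨Φ'.toPartialEquiv, Φ'.open_source, Φ'.open_target, ?_, ?_⟩, ⟨hx, hxS⟩, ?_⟩
  · exact Φ.contMDiffOn_toFun.mono fun y hy => hy.1
  · exact Φ.contMDiffOn_invFun.mono fun y hy => hy.1
  · intro y hy
    rw [hS y hy.2]
    exact hΦ hy.1

/-- The inverse function theorem. -/
theorem isLocalDiffeomorphAt_of_injective_mfderiv {f : X → Y} {x : X}
    (hf : ∀ᶠ y in 𝓝 x, ContMDiffAt I₁ J₁ ∞ f y)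
    (hinj : Function.Injective (mfderiv I₁ J₁ f x)) : IsLocalDiffeomorphAt I₁ J₁ ∞ f x := by
  let φ := extChartPartialDiffeomorph I₁ x
  let ψ := extChartPartialDiffeomorph J₁ (f x)
  have hfx := hf.self_of_nhds
  have hxs : x ∈ (extChartAt I₁ x).source := mem_extChartAt_source x
  set a := extChartAt I₁ x x
  let g : E₁ → E₁ := writtenInExtChartAt I₁ J₁ x f
  have hat : (extChartAt I₁ x).target ∈ 𝓝 a :=
    (isOpen_extChartAt_target x).mem_nhds (mem_extChartAt_target x)
  have hsymm : Tendsto (extChartAt I₁ x).symm (𝓝 a) (𝓝 x) := by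
    have h1 : ContinuousAt (extChartAt I₁ x).symm (extChartAt I₁ x x) :=
      continuousAt_extChartAt_symm x
    rwa [ContinuousAt, extChartAt_to_inv] at h1
  have hfs : ∀ᶠ y in 𝓝 x, f y ∈ (extChartAt J₁ (f x)).source :=
    hfx.continuousAt.eventually (extChartAt_source_mem_nhds (f x))
  have hg : ∀ᶠ y in 𝓝 a, ContDiffAt ℝ ∞ g y := by
    filter_upwards [hat, hsymm.eventually (hf.and hfs)] with y h1 h2
    rw [← contMDiffAt_iff_contDiffAt]
    have e1 : ContMDiffAt 𝓘(ℝ, E₁) I₁ ∞ (extChartAt I₁ x).symm y :=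
      φ.contMDiffOn_invFun.contMDiffAt ((isOpen_extChartAt_target x).mem_nhds h1)
    have e2 : ContMDiffAt J₁ 𝓘(ℝ, E₁) ∞ (extChartAt J₁ (f x)) (f ((extChartAt I₁ x).symm y)) :=
      ψ.contMDiffOn_toFun.contMDiffAt ((isOpen_extChartAt_source _).mem_nhds h2.2)
    exact e2.comp y (h2.1.comp y e1)
  have hd : fderiv ℝ g a = mfderiv I₁ J₁ f x := by
    let D : E₁ →L[ℝ] E₁ := mfderiv I₁ J₁ f x
    have h1 : HasFDerivWithinAt g D (Set.range I₁) a :=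
      ((hfx.mdifferentiableAt (by simp)).hasMFDerivAt).2
    rw [I₁.range_eq_univ, hasFDerivWithinAt_univ] at h1
    exact h1.fderiv
  obtain ⟨Ψ, haΨ, hΨ⟩ := isLocalDiffeomorphAt_of_injective_fderiv hg (by rw [hd]; exact hinj)
  have hga : g a = extChartAt J₁ (f x) (f x) := by simp [g, a, writtenInExtChartAt]
  have hcomp : IsLocalDiffeomorphAt I₁ J₁ ∞ ((φ.trans Ψ).trans ψ.symm) x := by
    refine PartialDiffeomorph.isLocalDiffeomorphAt I₁ J₁ ∞ _ ⟨⟨hxs, haΨ⟩, ?_⟩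
    change Ψ a ∈ (extChartAt J₁ (f x)).target
    rw [← hΨ haΨ, hga]
    exact mem_extChartAt_target _
  refine hcomp.congr_of_eventuallyEq ?_
  have hcφ : ContinuousAt (extChartAt I₁ x) x := continuousAt_extChartAt x
  have hxn : (extChartAt I₁ x).source ∈ 𝓝 x := extChartAt_source_mem_nhds x
  filter_upwards [hxn, hfs,
    hcφ.eventually (Ψ.open_source.mem_nhds haΨ)] with y h1 h2 h3
  change f y = (extChartAt J₁ (f x)).symm (Ψ (extChartAt I₁ x y))
  rw [← hΨ h3]
  simp only [g, writtenInExtChartAt, Function.comp_apply]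
  rw [(extChartAt I₁ x).left_inv h1, (extChartAt J₁ (f x)).left_inv h2]

omit [I₁.Boundaryless] [J₁.Boundaryless] [IsManifold I₁ ∞ X] [IsManifold J₁ ∞ Y]
  [FiniteDimensional ℝ E₁] in
/-- An injective local diffeomorphism is a partial diffeomorphism. -/
theorem exists_partialDiffeomorph_of_injOn [Nonempty X] {f : X → Y} {V : Set X} (hV : IsOpen V)
    (hf : ∀ x ∈ V, IsLocalDiffeomorphAt I₁ J₁ ∞ f x) (hinj : Set.InjOn f V) :
    ∃ Φ : PartialDiffeomorph I₁ J₁ X Y ∞, Φ.source = V ∧ ∀ x, Φ x = f x := by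
  have key : ∀ x ∈ V, ∃ Φ : PartialDiffeomorph I₁ J₁ X Y ∞, x ∈ Φ.source ∧
      Set.EqOn f Φ Φ.source ∧ Φ '' (Φ.source ∩ V) ∈ 𝓝 (f x) ∧ Φ '' (Φ.source ∩ V) ⊆ f '' V := by
    intro x hx
    obtain ⟨Φ, hxΦ, hΦ⟩ := hf x hx
    refine ⟨Φ, hxΦ, hΦ, ?_, ?_⟩
    · refine IsOpen.mem_nhds ?_ ⟨x, ⟨hxΦ, hx⟩, (hΦ hxΦ).symm⟩
      exact Φ.toOpenPartialHomeomorph.isOpen_image_of_subset_source (Φ.open_source.inter hV)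
        Set.inter_subset_left
    · rintro _ ⟨y, hy, rfl⟩
      exact ⟨y, hy.2, hΦ hy.1⟩
  refine ⟨⟨Set.InjOn.toPartialEquiv f V hinj, hV, ?_, ?_, ?_⟩, rfl, fun x => rfl⟩
  · change IsOpen (f '' V)
    rw [isOpen_iff_mem_nhds]
    rintro _ ⟨x, hx, rfl⟩
    obtain ⟨Φ, -, -, h3, h4⟩ := key x hx
    exact mem_of_superset h3 h4
  · intro x hx
    exact (hf x hx).contMDiffAt.contMDiffWithinAt
  · rintro _ ⟨x, hx, rfl⟩
    obtain ⟨Φ, h1, h2, h3, h4⟩ := key x hx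
    have h5 : ContMDiffAt J₁ I₁ ∞ Φ.symm (f x) := by
      refine Φ.contMDiffOn_invFun.contMDiffAt (Φ.open_target.mem_nhds ?_)
      rw [h2 h1]
      exact Φ.map_source h1
    refine (h5.congr_of_eventuallyEq ?_).contMDiffWithinAt
    filter_upwards [h3] with y hy
    obtain ⟨z, hz, rfl⟩ := hy
    have e1 : (Set.InjOn.toPartialEquiv f V hinj).symm (f z) = z :=
      (Set.InjOn.toPartialEquiv f V hinj).left_inv hz.2
    have e2 : Φ.symm (Φ z) = z := Φ.left_inv hz.1
    rw [e2, ← h2 hz.1]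
    exact e1

end InverseFunction

section ExistsLocalAddition

/-! ### Existence of local additions -/

variable {E : Type v} [NormedAddCommGroup E] [NormedSpace ℝ E]
  {M : Type u} [TopologicalSpace M] [ChartedSpace E M] [IsManifold 𝓘(ℝ, E) ∞ M]

/-- Vectors in one fibre are separated in a trivialisation, others by their base points. It serves
to extend injectivity from a compact set to a neighbourhood. -/
theorem t2Space_tangentBundle [T2Space M] : T2Space (TangentBundle 𝓘(ℝ, E) M) := by
  refine ⟨fun ξ η hne => ?_⟩
  by_cases h : ξ.proj = η.proj
  · set e := trivializationAt E (TangentSpace 𝓘(ℝ, E)) ξ.proj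
    have h1 : ξ ∈ e.source := e.mem_source.2 (FiberBundle.mem_baseSet_trivializationAt' _)
    have h2 : η ∈ e.source := e.mem_source.2 (by
      rw [← h]; exact FiberBundle.mem_baseSet_trivializationAt' _)
    have h3 : e ξ ≠ e η := fun h4 => hne (e.injOn h1 h2 h4)
    obtain ⟨U, V, hU, hV, hξ, hη, hd⟩ := t2_separation h3
    refine ⟨e.source ∩ e ⁻¹' U, e.source ∩ e ⁻¹' V,
      e.continuousOn.isOpen_inter_preimage e.open_source hU,
      e.continuousOn.isOpen_inter_preimage e.open_source hV, ⟨h1, hξ⟩, ⟨h2, hη⟩, ?_⟩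
    exact (hd.preimage e).mono Set.inter_subset_right Set.inter_subset_right
  · exact separated_by_continuous (FiberBundle.continuous_proj E (TangentSpace 𝓘(ℝ, E))) h

variable [FiniteDimensional ℝ E] {ι : Type} [Fintype ι] {p : ι → M}
  (b : ∀ i, SmoothBumpFunction 𝓘(ℝ, E) (p i))

/-- The difference `ψ y - ψ x` of the coordinates of two points in a chart, cut off. -/
noncomputable def SmoothBumpFunction.diffCoord {c : M} (b : SmoothBumpFunction 𝓘(ℝ, E) c)
    (z : M × M) : E :=
  -- Each coordinate is cut off at its own point, which makes both terms globally smooth; the other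
  -- bump factor gives them the common weight `b z.1 * b z.2`.
  b z.1 • (b z.2 • extChartAt 𝓘(ℝ, E) c z.2) - b z.2 • (b z.1 • extChartAt 𝓘(ℝ, E) c z.1)

/-- A smooth map `M × M → TM` over the first projection, which near the diagonal over the union of
the supports of the bump functions is a diffeomorphism. -/
noncomputable def bumpDifference (z : M × M) : TangentBundle 𝓘(ℝ, E) M :=
  -- This additional factor cuts off the local trivialisation, which is only defined over the chart
  -- domain.
  ⟨z.1, ∑ i, b i z.1 •
    (trivializationAt E (TangentSpace 𝓘(ℝ, E)) (p i)).symmL ℝ z.1 ((b i).diffCoord z)⟩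

/-- The coordinate change from the chart at `c` to the chart at `x₀`, cut off. -/
noncomputable def SmoothBumpFunction.coordChange {c : M} (b : SmoothBumpFunction 𝓘(ℝ, E) c)
    (x₀ x : M) : E →L[ℝ] E :=
  b x • ((trivializationAt E (TangentSpace 𝓘(ℝ, E)) x₀).continuousLinearMapAt ℝ x).comp
    ((trivializationAt E (TangentSpace 𝓘(ℝ, E)) c).symmL ℝ x)

theorem trivializationAt_bumpDifference {x₀ : M} {z : M × M}
    (h : z.1 ∈ (trivializationAt E (TangentSpace 𝓘(ℝ, E)) x₀).baseSet) :
    (trivializationAt E (TangentSpace 𝓘(ℝ, E)) x₀ (bumpDifference b z)).2 =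
      ∑ i, (b i).coordChange x₀ z.1 ((b i).diffCoord z) := by
  set e := trivializationAt E (TangentSpace 𝓘(ℝ, E)) x₀
  have h1 : ∀ v : TangentSpace 𝓘(ℝ, E) z.1, (e ⟨z.1, v⟩).2 = e.continuousLinearMapAt ℝ z.1 v := by
    intro v
    rw [Bundle.Trivialization.continuousLinearMapAt_apply,
      Bundle.Trivialization.coe_linearMapAt_of_mem _ h]
  refine (h1 _).trans ?_
  rw [map_sum]
  refine Finset.sum_congr rfl fun i _ => ?_
  rw [map_smul]
  rfl

theorem bumpDifference_diag (x : M) :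
    bumpDifference b (x, x) = (⟨x, 0⟩ : TangentBundle 𝓘(ℝ, E) M) := by
  refine congrArg (Bundle.TotalSpace.mk x) (Finset.sum_eq_zero fun i _ => ?_)
  simp [SmoothBumpFunction.diffCoord]

variable [T2Space M]

theorem SmoothBumpFunction.contMDiff_diffCoord {c : M} (b : SmoothBumpFunction 𝓘(ℝ, E) c) :
    ContMDiff (𝓘(ℝ, E).prod 𝓘(ℝ, E)) 𝓘(ℝ, E) ∞ b.diffCoord := by
  have h1 : ContMDiff 𝓘(ℝ, E) 𝓘(ℝ, E) ∞ (fun x => b x • extChartAt 𝓘(ℝ, E) c x) :=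
    b.contMDiff_smul contMDiffOn_extChartAt
  have h2 : ContMDiff 𝓘(ℝ, E) 𝓘(ℝ, ℝ) ∞ b := b.contMDiff
  exact ((h2.comp contMDiff_fst).smul (h1.comp contMDiff_snd)).sub
    ((h2.comp contMDiff_snd).smul (h1.comp contMDiff_fst))

/-- Over the chart domain at `c` this is a smooth coordinate change times a smooth function; at any
other `x₀` the bump function vanishes nearby. -/
theorem SmoothBumpFunction.contMDiffAt_coordChange {c : M} (b : SmoothBumpFunction 𝓘(ℝ, E) c)
    (x₀ : M) : ContMDiffAt 𝓘(ℝ, E) 𝓘(ℝ, E →L[ℝ] E) ∞ (b.coordChange x₀) x₀ := by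
  set e := trivializationAt E (TangentSpace 𝓘(ℝ, E)) c
  set e' := trivializationAt E (TangentSpace 𝓘(ℝ, E)) x₀
  by_cases hx : x₀ ∈ e.baseSet
  · have hx' : x₀ ∈ e'.baseSet := FiberBundle.mem_baseSet_trivializationAt' _
    have h1 : ContMDiffAt 𝓘(ℝ, E) 𝓘(ℝ, E →L[ℝ] E) ∞
        (fun x => (e.coordChangeL ℝ e' x : E →L[ℝ] E)) x₀ :=
      contMDiffAt_coordChangeL hx hx'
    refine ((b.contMDiff.contMDiffAt (x := x₀)).smul h1).congr_of_eventuallyEq ?_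
    filter_upwards [(e.open_baseSet.inter e'.open_baseSet).mem_nhds ⟨hx, hx'⟩] with x hxx
    simp only [coordChange]
    congr 1
    ext v
    rw [ContinuousLinearEquiv.coe_coe, e.coordChangeL_apply e' hxx]
    simp only [ContinuousLinearMap.comp_apply]
    rw [Bundle.Trivialization.continuousLinearMapAt_apply,
      Bundle.Trivialization.coe_linearMapAt_of_mem _ hxx.2]
    change (e' ⟨x, e.symmL ℝ x v⟩).2 = _
    rw [Bundle.Trivialization.symmL_apply e hxx.1]
  · have h0 : x₀ ∉ tsupport b := fun h => hx (b.tsupport_subset_chartAt_source h)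
    have h1 : ∀ᶠ x in 𝓝 x₀, x ∉ tsupport b :=
      (isClosed_tsupport b).isOpen_compl.mem_nhds h0
    refine (contMDiffAt_const (c := (0 : E →L[ℝ] E))).congr_of_eventuallyEq ?_
    filter_upwards [h1] with x hx'
    simp [coordChange, image_eq_zero_of_notMem_tsupport hx']

theorem contMDiff_bumpDifference :
    ContMDiff (𝓘(ℝ, E).prod 𝓘(ℝ, E)) 𝓘(ℝ, E).tangent ∞ (bumpDifference b) := by
  intro z
  refine Bundle.contMDiffAt_totalSpace.2 ⟨contMDiffAt_fst, ?_⟩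
  set e := trivializationAt E (TangentSpace 𝓘(ℝ, E)) z.1
  have h1 : ContMDiffAt (𝓘(ℝ, E).prod 𝓘(ℝ, E)) 𝓘(ℝ, E) ∞
      (fun w : M × M => ∑ i, (b i).coordChange z.1 w.1 ((b i).diffCoord w)) z := by
    refine contMDiffAt_finsetSum fun i _ => ?_
    have h2 : ContMDiffAt (𝓘(ℝ, E).prod 𝓘(ℝ, E)) 𝓘(ℝ, E →L[ℝ] E) ∞
        (fun w : M × M => (b i).coordChange z.1 w.1) z :=
      ((b i).contMDiffAt_coordChange z.1).comp z contMDiffAt_fst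
    exact h2.clm_apply (b i).contMDiff_diffCoord.contMDiffAt
  refine h1.congr_of_eventuallyEq ?_
  filter_upwards [continuousAt_fst.eventually
    (e.open_baseSet.mem_nhds (FiberBundle.mem_baseSet_trivializationAt' z.1))] with w hw
  exact trivializationAt_bumpDifference b hw

-- Since `g` vanishes at `x`, the term with the derivative of `f` drops out of the product rule.
-- This removes the derivatives of the bump functions on the diagonal.
omit [IsManifold 𝓘(ℝ, E) ∞ M] [FiniteDimensional ℝ E] [T2Space M] in
theorem hasMFDerivAt_smul_of_eq_zero {f : M → ℝ} {g : M → E} {x : M} {g' : E →L[ℝ] E}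
    (hf : MDifferentiableAt 𝓘(ℝ, E) 𝓘(ℝ, ℝ) f x)
    (hg : HasMFDerivAt 𝓘(ℝ, E) 𝓘(ℝ, E) g x g') (h0 : g x = 0) :
    HasMFDerivAt 𝓘(ℝ, E) 𝓘(ℝ, E) (fun y => f y • g y) x (f x • g') := by
  refine ⟨hf.continuousAt.smul hg.1, ?_⟩
  set φ := extChartAt 𝓘(ℝ, E) x
  let f' : E →L[ℝ] ℝ := mfderiv 𝓘(ℝ, E) 𝓘(ℝ, ℝ) f x
  have h1 : HasFDerivWithinAt (fun q => f (φ.symm q)) f' (Set.range 𝓘(ℝ, E)) (φ x) :=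
    hf.hasMFDerivAt.2
  have h2 : HasFDerivWithinAt (fun q => g (φ.symm q)) g' (Set.range 𝓘(ℝ, E)) (φ x) := hg.2
  have h3 := h1.fun_smul h2
  rw [extChartAt_to_inv, h0] at h3
  have h4 : (f x • g' + f'.smulRight (0 : E)) = f x • g' := by ext; simp
  rw [h4] at h3
  exact h3

/-- In the `i`-th summand the derivative of the coordinate difference cancels against the inverse
trivialisation. What remains are three bump factors at `x`: one from the cut-off frame and two from
the cut-off difference. -/
theorem hasMFDerivAt_bumpDifference (x : M) :
    HasMFDerivAt 𝓘(ℝ, E) 𝓘(ℝ, E) (fun y =>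
      (trivializationAt E (TangentSpace 𝓘(ℝ, E)) x (bumpDifference b (x, y))).2) x
      ((∑ i, b i x ^ 3) • ContinuousLinearMap.id ℝ E : E →L[ℝ] E) := by
  set e := trivializationAt E (TangentSpace 𝓘(ℝ, E)) x
  have hx : x ∈ e.baseSet := FiberBundle.mem_baseSet_trivializationAt' x
  have h1 : ∀ i, HasMFDerivAt 𝓘(ℝ, E) 𝓘(ℝ, E)
      (fun y => (b i).coordChange x x ((b i).diffCoord (x, y))) x
      (b i x ^ 3 • ContinuousLinearMap.id ℝ E : E →L[ℝ] E) := by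
    intro i
    by_cases hi : x ∈ (chartAt E (p i)).source
    · set ψ := extChartAt 𝓘(ℝ, E) (p i)
      let K := (b i).coordChange x x
      let D : E →L[ℝ] E := mfderiv 𝓘(ℝ, E) 𝓘(ℝ, E) ψ x
      have hψ : HasMFDerivAt 𝓘(ℝ, E) 𝓘(ℝ, E) (fun y => ψ y - ψ x) x D := by
        have h2 : HasMFDerivAt 𝓘(ℝ, E) 𝓘(ℝ, E) (fun _ : M => ψ x) x (0 : E →L[ℝ] E) :=
          hasMFDerivAt_const (ψ x) x
        have h3 : HasMFDerivAt 𝓘(ℝ, E) 𝓘(ℝ, E) ψ x D :=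
          (mdifferentiableAt_extChartAt hi).hasMFDerivAt
        exact (h3.sub h2).congr_mfderiv (sub_zero D)
      have h4 := hasMFDerivAt_smul_of_eq_zero
        ((b i).contMDiffAt.mdifferentiableAt (x := x) (by simp)) hψ (sub_self _)
      have h5 := (h4.const_smul (b i x))
      have h6 : HasMFDerivAt 𝓘(ℝ, E) 𝓘(ℝ, E) (fun y => K ((b i).diffCoord (x, y))) x
          (K.comp (b i x • b i x • D)) := by
        refine (K.hasMFDerivAt.comp x h5).congr_of_eventuallyEq ?_
        filter_upwards with y
        simp only [SmoothBumpFunction.diffCoord, Function.comp_apply, Pi.smul_apply]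
        congr 1
        rw [smul_sub, smul_sub, smul_comm (b i x) (b i y) (ψ x)]
      refine h6.congr_mfderiv ?_
      refine ContinuousLinearMap.ext fun (v : E) => ?_
      have hD : D v = (trivializationAt E (TangentSpace 𝓘(ℝ, E)) (p i)).continuousLinearMapAt ℝ x v :=
        (DFunLike.congr_fun (TangentBundle.continuousLinearMapAt_trivializationAt hi) v).symm
      have hK : K (D v) = b i x • v := by
        rw [hD]
        have h8 := (trivializationAt E (TangentSpace 𝓘(ℝ, E)) (p i)).symmL_continuousLinearMapAt
          (R := ℝ) hi v
        refine (congrArg (fun y => b i x • e.continuousLinearMapAt ℝ x y) h8).trans ?_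
        -- The trivialisation centred at `x` is the identity on the fibre over `x` itself.
        have h7 : e.continuousLinearMapAt ℝ x v = v := DFunLike.congr_fun
          ((TangentBundle.continuousLinearMapAt_trivializationAt (mem_chart_source E x)).trans
            mfderiv_extChartAt_self) v
        exact congrArg (fun y : E => b i x • y) h7
      change K (b i x • b i x • D v) = b i x ^ 3 • v
      rw [map_smul, map_smul, hK, smul_smul, smul_smul]
      congr 1
      ring
    · have h0 : b i x = 0 := by
        by_contra h
        exact hi ((b i).support_subset_source h)
      have hz : (b i).coordChange x x = 0 := by
        simp only [SmoothBumpFunction.coordChange, h0]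
        exact zero_smul ℝ _
      have hz' : (b i x ^ 3 • ContinuousLinearMap.id ℝ E : E →L[ℝ] E) = 0 := by simp [h0]
      rw [hz, hz']
      exact hasMFDerivAt_const (0 : E) x
  have h2 := HasMFDerivAt.sum (t := Finset.univ)
    (f := fun i y => (b i).coordChange x x ((b i).diffCoord (x, y)))
    (f' := fun i => (b i x ^ 3 • ContinuousLinearMap.id ℝ E : E →L[ℝ] E)) fun i _ => h1 i
  rw [Finset.sum_smul]
  refine h2.congr_of_eventuallyEq ?_
  filter_upwards with y
  rw [trivializationAt_bumpDifference b hx, Finset.sum_apply]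

/-- The derivative at `(x, x)` is block triangular: projecting to the base returns the first
component, and on vectors `(0, w)` the fibre part is multiplication by `∑ i, b i x ^ 3 > 0`. Hence
it is injective, and the inverse function theorem applies. -/
theorem isLocalDiffeomorphAt_bumpDifference {x : M} (hx : ∃ i, b i x ≠ 0) :
    IsLocalDiffeomorphAt (𝓘(ℝ, E).prod 𝓘(ℝ, E)) 𝓘(ℝ, E).tangent ∞ (bumpDifference b) (x, x) := by
  have hsm := contMDiff_bumpDifference b
  refine isLocalDiffeomorphAt_of_injective_mfderiv (.of_forall fun y => hsm.contMDiffAt) ?_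
  set e := trivializationAt E (TangentSpace 𝓘(ℝ, E)) x
  let D : E × E →L[ℝ] E × E :=
    mfderiv (𝓘(ℝ, E).prod 𝓘(ℝ, E)) 𝓘(ℝ, E).tangent (bumpDifference b) (x, x)
  have hD : HasMFDerivAt (𝓘(ℝ, E).prod 𝓘(ℝ, E)) 𝓘(ℝ, E).tangent (bumpDifference b) (x, x) D :=
    (hsm.contMDiffAt.mdifferentiableAt (by simp)).hasMFDerivAt
  change Function.Injective D
  rw [injective_iff_map_eq_zero]
  rintro ⟨u, w⟩ huw
  have hu : u = 0 := by
    have h1 : MDifferentiableAt 𝓘(ℝ, E).tangent 𝓘(ℝ, E)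
        (Bundle.TotalSpace.proj : TangentBundle 𝓘(ℝ, E) M → M) (bumpDifference b (x, x)) :=
      (Bundle.contMDiff_proj (n := 1) (TangentSpace 𝓘(ℝ, E))).contMDiffAt.mdifferentiableAt
        (by simp)
    let P : E × E →L[ℝ] E := mfderiv 𝓘(ℝ, E).tangent 𝓘(ℝ, E)
      (Bundle.TotalSpace.proj : TangentBundle 𝓘(ℝ, E) M → M) (bumpDifference b (x, x))
    have h2 : HasMFDerivAt (𝓘(ℝ, E).prod 𝓘(ℝ, E)) 𝓘(ℝ, E) (Prod.fst : M × M → M) (x, x)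
        (P.comp D) := h1.hasMFDerivAt.comp (x, x) hD
    have h3 : HasMFDerivAt (𝓘(ℝ, E).prod 𝓘(ℝ, E)) 𝓘(ℝ, E) (Prod.fst : M × M → M) (x, x)
        (ContinuousLinearMap.fst ℝ E E) := hasMFDerivAt_fst (x, x)
    have h4 : P (D (u, w)) = u := DFunLike.congr_fun (hasMFDerivAt_unique h2 h3) (u, w)
    rw [← h4, huw, map_zero]
  subst hu
  have hw : w = 0 := by
    have h1 : MDifferentiableAt 𝓘(ℝ, E).tangent 𝓘(ℝ, E)
        (fun ξ : TangentBundle 𝓘(ℝ, E) M => (e ξ).2) (bumpDifference b (x, x)) := by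
      have h2 : ContMDiffAt 𝓘(ℝ, E).tangent (𝓘(ℝ, E).prod 𝓘(ℝ, E)) ∞ e
          (bumpDifference b (x, x)) :=
        (Bundle.Trivialization.contMDiffOn (IB := 𝓘(ℝ, E)) e).contMDiffAt
          (e.open_source.mem_nhds (e.mem_source.2 (FiberBundle.mem_baseSet_trivializationAt' x)))
      exact (contMDiffAt_snd.comp _ h2).mdifferentiableAt (by simp)
    let P : E × E →L[ℝ] E := mfderiv 𝓘(ℝ, E).tangent 𝓘(ℝ, E)
        (fun ξ : TangentBundle 𝓘(ℝ, E) M => (e ξ).2) (bumpDifference b (x, x))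
    have h2 : HasMFDerivAt 𝓘(ℝ, E) (𝓘(ℝ, E).prod 𝓘(ℝ, E)) (fun y : M => (x, y)) x
        (ContinuousLinearMap.inr ℝ E E) :=
      (hasMFDerivAt_const x x).prodMk (hasMFDerivAt_id x)
    have h3 : HasMFDerivAt 𝓘(ℝ, E) 𝓘(ℝ, E) (fun y => (e (bumpDifference b (x, y))).2) x
        (P.comp (D.comp (ContinuousLinearMap.inr ℝ E E))) :=
      HasMFDerivAt.comp (f := fun y => bumpDifference b (x, y)) x h1.hasMFDerivAt
        (HasMFDerivAt.comp (g := bumpDifference b) x hD h2)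
    have h4 : P (D (0, w)) = (∑ i, b i x ^ 3) • w :=
      DFunLike.congr_fun (hasMFDerivAt_unique h3 (hasMFDerivAt_bumpDifference b x)) w
    rw [huw, map_zero] at h4
    refine (smul_eq_zero.1 h4.symm).resolve_left (ne_of_gt ?_)
    obtain ⟨i, hi⟩ := hx
    exact Finset.sum_pos' (fun j _ => pow_nonneg (b j).nonneg 3)
      ⟨i, Finset.mem_univ i, pow_pos (lt_of_le_of_ne (b i).nonneg hi.symm) 3⟩
  rw [hw]
  rfl

/-- Around every path there is a local addition. -/
theorem exists_localAddition (γ : C(I, M)) : ∃ α : LocalAddition E M,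
    ∀ t, (⟨γ t, 0⟩ : TangentBundle 𝓘(ℝ, E) M) ∈ α.toHomeo.source := by
  have : T2Space (TangentBundle 𝓘(ℝ, E) M) := t2Space_tangentBundle
  have : Nonempty (M × M) := ⟨(γ 0, γ 0)⟩
  have hK : IsCompact (Set.range γ) := isCompact_range γ.continuous
  obtain ⟨b₀⟩ : Nonempty (∀ x : M, SmoothBumpFunction 𝓘(ℝ, E) x) :=
    ⟨fun x => Classical.arbitrary _⟩
  obtain ⟨s, -, hs⟩ := hK.elim_nhds_subcover (fun x => Function.support (b₀ x))
    fun x _ => (b₀ x).support_mem_nhds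
  let p : Fin s.card → M := fun i => s.equivFin.symm i
  let b : ∀ i, SmoothBumpFunction 𝓘(ℝ, E) (p i) := fun i => b₀ (p i)
  have hb : ∀ t, ∃ i, b i (γ t) ≠ 0 := by
    intro t
    obtain ⟨x, hx, hxt⟩ := Set.mem_iUnion₂.1 (hs ⟨t, rfl⟩)
    refine ⟨s.equivFin ⟨x, hx⟩, ?_⟩
    have hp : p (s.equivFin ⟨x, hx⟩) = x := by simp [p]
    change b₀ (p (s.equivFin ⟨x, hx⟩)) (γ t) ≠ 0
    rw [hp]
    exact hxt
  let θ := bumpDifference b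
  have hθ := contMDiff_bumpDifference b
  have hdiag : ∀ x, θ (x, x) = ⟨x, 0⟩ := bumpDifference_diag b
  let C : Set (M × M) := Set.range fun t => (γ t, γ t)
  have hC : IsCompact C := isCompact_range (by fun_prop)
  have hloc : ∀ z ∈ C,
      IsLocalDiffeomorphAt (𝓘(ℝ, E).prod 𝓘(ℝ, E)) 𝓘(ℝ, E).tangent ∞ θ z := by
    rintro _ ⟨t, rfl⟩
    exact isLocalDiffeomorphAt_bumpDifference b (hb t)
  have hinj : Set.InjOn θ C := by
    rintro _ ⟨t, rfl⟩ _ ⟨t', rfl⟩ h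
    have h1 : γ t = γ t' := congrArg Bundle.TotalSpace.proj h
    simp only [h1]
  -- Injectivity on the compact set `C` together with local injectivity at its points gives
  -- injectivity on a neighbourhood.
  obtain ⟨V₀, hV₀, hCV₀, hinjV₀⟩ := hinj.exists_isOpen_superset hC
    (fun z _ => hθ.continuous.continuousAt) fun z hz => by
      obtain ⟨Φ, hzΦ, hΦ⟩ := hloc z hz
      exact ⟨Φ.source, Φ.open_source.mem_nhds hzΦ, fun y hy y' hy' h =>
        Φ.injOn hy hy' (by rw [← hΦ hy, ← hΦ hy']; exact h)⟩
  let N : Set (M × M) := interior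
    {z | IsLocalDiffeomorphAt (𝓘(ℝ, E).prod 𝓘(ℝ, E)) 𝓘(ℝ, E).tangent ∞ θ z}
  have hCN : C ⊆ N := by
    intro z hz
    obtain ⟨Φ, hzΦ, hΦ⟩ := hloc z hz
    exact mem_interior.2 ⟨Φ.source, fun y hy => ⟨Φ, hy, hΦ⟩, Φ.open_source, hzΦ⟩
  let V₁ : Set (M × M) := V₀ ∩ N
  have hV₁ : IsOpen V₁ := hV₀.inter isOpen_interior
  -- With a pair `(x, y)` the diagonal point `(x, x)` must also lie where `θ` is injective;
  -- otherwise a zero vector over `x` could come from an off-diagonal pair, violating `map_zero`.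
  let V : Set (M × M) := V₁ ∩ {z | (z.1, z.1) ∈ V₁}
  have hV : IsOpen V := hV₁.inter (hV₁.preimage (by fun_prop))
  have hdV : ∀ t, (γ t, γ t) ∈ V := fun t =>
    have h : (γ t, γ t) ∈ V₁ := ⟨hCV₀ ⟨t, rfl⟩, hCN ⟨t, rfl⟩⟩
    ⟨h, h⟩
  have hinjV : Set.InjOn θ V := hinjV₀.mono fun z hz => hz.1.1
  have hlocV : ∀ z ∈ V, IsLocalDiffeomorphAt (𝓘(ℝ, E).prod 𝓘(ℝ, E)) 𝓘(ℝ, E).tangent ∞ θ z := by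
    intro z hz
    have hzN : z ∈ N := hz.1.2
    exact (interior_subset : N ⊆ {z | IsLocalDiffeomorphAt (𝓘(ℝ, E).prod 𝓘(ℝ, E))
      𝓘(ℝ, E).tangent ∞ θ z}) hzN
  obtain ⟨Φ, hΦV, hΦ⟩ := exists_partialDiffeomorph_of_injOn hV hlocV hinjV
  have hΦs : ∀ {ξ}, ξ ∈ Φ.target → ∃ z ∈ V, θ z = ξ ∧ Φ.symm ξ = z := by
    intro ξ hξ
    refine ⟨Φ.symm ξ, hΦV ▸ Φ.map_target hξ, ?_, rfl⟩
    exact (hΦ _).symm.trans (Φ.right_inv hξ)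
  refine ⟨⟨Φ.toOpenPartialHomeomorph.symm, ?_, ?_, Φ.contMDiffOn_invFun, Φ.contMDiffOn_toFun⟩, ?_⟩
  · intro ξ hξ
    obtain ⟨z, hz, rfl, hz'⟩ := hΦs hξ
    exact congrArg Prod.fst hz'
  · intro x hx
    obtain ⟨z, hz, hz', hzx⟩ := hΦs hx
    have h1 : z.1 = x := congrArg Bundle.TotalSpace.proj hz'
    refine hzx.trans (hinjV₀ hz.1.1 ?_ ?_)
    · rw [← h1]
      exact hz.2.1
    · rw [hz', hdiag]
  · intro t
    change (⟨γ t, 0⟩ : TangentBundle 𝓘(ℝ, E) M) ∈ Φ.target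
    rw [← hdiag, ← hΦ]
    exact Φ.map_source (hΦV ▸ hdV t)

end ExistsLocalAddition

section PathManifold

/-! ### The smooth structure of the path space -/

variable {E : Type v} [NormedAddCommGroup E] [NormedSpace ℝ E] [FiniteDimensional ℝ E]
  {M : Type u} [TopologicalSpace M] [ChartedSpace E M] [IsManifold 𝓘(ℝ, E) ∞ M]

theorem exists_isPathChart [T2Space M] (γ : C(I, M)) : ∃ e, IsPathChart E M e ∧ γ ∈ e.source := by
  obtain ⟨α, hα⟩ := exists_localAddition (E := E) γ
  exact α.exists_isPathChart hα

/-- The atlas consists of all path charts, for all local additions and frames, so none of them is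
distinguished. -/
theorem exists_isPathManifold (E : Type v) [NormedAddCommGroup E] [NormedSpace ℝ E]
    [FiniteDimensional ℝ E] (M : Type u) [TopologicalSpace M] [ChartedSpace E M]
    [IsManifold 𝓘(ℝ, E) ∞ M] [T2Space M] :
    ∃ (_cP : ChartedSpace C(I, E) C(I, M)) (_mP : IsManifold 𝓘(ℝ, C(I, E)) ∞ C(I, M)),
      IsPathManifold E M := by
  choose e he hγ using fun γ : C(I, M) => exists_isPathChart (E := E) γ
  let cP : ChartedSpace C(I, E) C(I, M) :=
    { atlas := {e | IsPathChart E M e}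
      chartAt := e
      mem_chart_source := hγ
      chart_mem_atlas := he }
  have mP : IsManifold 𝓘(ℝ, C(I, E)) ∞ C(I, M) := by
    refine isManifold_of_contDiffOn _ _ _ fun e e' h h' => ?_
    obtain ⟨γ, α, A, h1⟩ := IsPathChart.exists_isPathChartOf h
    obtain ⟨γ', α', A', h1'⟩ := IsPathChart.exists_isPathChartOf h'
    simpa using! h1.contDiffOn_transition h1'
  exact ⟨cP, mP, ⟨fun γ => ⟨e γ, he γ, hγ γ⟩,
    fun e h => IsManifold.subset_maximalAtlas h⟩⟩

/-- In a path chart the evaluation at `t` is the continuous linear evaluation on `C(I, E)` followed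
by the smooth map `α.kernel A (t, ·)`. -/
theorem IsPathManifold.contMDiff_eval [ChartedSpace C(I, E) C(I, M)]
    [IsManifold 𝓘(ℝ, C(I, E)) ∞ C(I, M)] (hP : IsPathManifold E M) (t : I) :
    ContMDiff 𝓘(ℝ, C(I, E)) 𝓘(ℝ, E) ∞ (fun η : C(I, M) => η t) := by
  intro η
  obtain ⟨e, he, hη⟩ := hP.covers η
  have h1 := contMDiffAt_of_mem_maximalAtlas (hP.mem_maximalAtlas e he) hη
  obtain ⟨γ, α, A, h2⟩ := he.exists_isPathChartOf
  have h3 : ContMDiffAt 𝓘(ℝ, E) 𝓘(ℝ, E) ∞ (fun v => α.kernel A (t, v)) (e η t) :=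
    (α.paramSmoothAt_kernel A (h2.lift_mem (e.map_source hη) t)).contMDiffAt_slice
  have h4 : ContMDiffAt 𝓘(ℝ, C(I, E)) 𝓘(ℝ, E) ∞ (ContinuousMap.evalCLM ℝ t : C(I, E) →L[ℝ] E)
      (e η) := (ContinuousLinearMap.contDiff _).contMDiff.contMDiffAt
  refine (ContMDiffAt.comp η (g := fun f : C(I, E) => α.kernel A (t, f t)) (f := e)
    (ContMDiffAt.comp (e η) (g := fun v => α.kernel A (t, v)) h3 h4) h1).congr_of_eventuallyEq ?_
  filter_upwards [e.open_source.mem_nhds hη] with η' hη'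
  have h5 := h2.symm_apply _ (e.map_source hη') t
  rwa [e.left_inv hη'] at h5

end PathManifold

/-! ### Submanifolds given by slice charts -/

section Slice

variable {B : Type*} [NormedAddCommGroup B] [NormedSpace ℝ B] {P : Type*} [TopologicalSpace P]
  [ChartedSpace B P] {q : P → Prop} {B' : Submodule ℝ B}

/-- A chart of `P` in which the subset defined by `q` corresponds to the subspace `B'`. -/
structure IsSliceChart (q : P → Prop) (B' : Submodule ℝ B) (e : OpenPartialHomeomorph P B) :
    Prop where
  mem_maximalAtlas : e ∈ IsManifold.maximalAtlas 𝓘(ℝ, B) ∞ P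
  mem_iff : ∀ p ∈ e.source, q p ↔ e p ∈ B'

open Classical in
/-- The chart of the subset defined by `q` given by a slice chart. -/
noncomputable def IsSliceChart.chart {e : OpenPartialHomeomorph P B} (h : IsSliceChart q B' e)
    (pr : B →L[ℝ] B') (hpr : ∀ f : B', pr f = f) (p₀ : {p // q p}) :
    OpenPartialHomeomorph {p // q p} B' where
  toFun p := pr (e p)
  -- On the target the condition always holds, by `mem_iff`; `p₀` is only a filler elsewhere.
  invFun f := if h : q (e.symm f) then ⟨e.symm f, h⟩ else p₀
  source := {p : {p // q p} | (p : P) ∈ e.source}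
  target := {f : B' | (f : B) ∈ e.target}
  map_source' p hp := by
    have h1 : ((pr (e p) : B') : B) = e p :=
      congrArg Subtype.val (hpr ⟨e p, (h.mem_iff _ hp).1 p.2⟩)
    simp only [Set.mem_ofPred_eq, h1]
    exact e.map_source hp
  map_target' f hf := by
    have h1 : q (e.symm f) := by
      rw [h.mem_iff _ (e.map_target hf), e.right_inv hf]
      exact f.2
    simp only [Set.mem_ofPred_eq, dif_pos h1]
    exact e.map_target hf
  left_inv' p hp := by
    have h1 : ((pr (e p) : B') : B) = e p :=
      congrArg Subtype.val (hpr ⟨e p, (h.mem_iff _ hp).1 p.2⟩)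
    have h2 : e.symm (pr (e p) : B') = p := by rw [h1, e.left_inv hp]
    have h3 : q (e.symm (pr (e p) : B')) := by rw [h2]; exact p.2
    simp only [dif_pos h3]
    exact Subtype.ext h2
  right_inv' f hf := by
    have h1 : q (e.symm f) := by
      rw [h.mem_iff _ (e.map_target hf), e.right_inv hf]
      exact f.2
    simp only [dif_pos h1, e.right_inv hf, hpr]
  open_source := e.open_source.preimage continuous_subtype_val
  open_target := e.open_target.preimage continuous_subtype_val
  continuousOn_toFun := pr.continuous.comp_continuousOn
    (e.continuousOn.comp continuous_subtype_val.continuousOn fun p hp => hp)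
  continuousOn_invFun := by
    refine continuousOn_iff_continuous_domRestrict.2 (continuous_induced_rng.2 ?_)
    have h0 : ContinuousOn (fun f : B' => e.symm f) {f : B' | ↑f ∈ e.target} :=
      e.continuousOn_symm.comp continuous_subtype_val.continuousOn fun f hf => hf
    refine (continuousOn_iff_continuous_domRestrict.1 h0).congr fun f => ?_
    have hf : (f : B) ∈ e.target := f.2
    have h1 : q (e.symm f) := by
      rw [h.mem_iff _ (e.map_target hf), e.right_inv hf]
      exact f.1.2
    simp only [Function.comp_apply, Set.domRestrict_apply, dif_pos h1]

section Chart

variable {e : OpenPartialHomeomorph P B} (h : IsSliceChart q B' e)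
    (pr : B →L[ℝ] B') (hpr : ∀ f : B', pr f = f) (p₀ : {p // q p})

theorem IsSliceChart.coe_chart_symm {f : B'} (hf : f ∈ (h.chart pr hpr p₀).target) :
    ((h.chart pr hpr p₀).symm f : P) = e.symm f := by
  have hf' : (f : B) ∈ e.target := hf
  have h1 : q (e.symm f) := by
    rw [h.mem_iff _ (e.map_target hf'), e.right_inv hf']
    exact f.2
  exact congrArg Subtype.val (dif_pos h1)

theorem IsSliceChart.coe_chart {p : {p // q p}} (hp : p ∈ (h.chart pr hpr p₀).source) :
    ((h.chart pr hpr p₀ p : B') : B) = e p :=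
  congrArg Subtype.val (hpr ⟨e p, (h.mem_iff _ hp).1 p.2⟩)

end Chart

variable (pr : B →L[ℝ] B') (hpr : ∀ f : B', pr f = f)
  {e : {p // q p} → OpenPartialHomeomorph P B} (he : ∀ p, IsSliceChart q B' (e p))
  (hmem : ∀ p, ↑p ∈ (e p).source)

/-- The charted space structure defined by a family of slice charts. -/
@[reducible] noncomputable def sliceChartedSpace : ChartedSpace B' {p // q p} where
  atlas := Set.range fun p => (he p).chart pr hpr p
  chartAt p := (he p).chart pr hpr p
  mem_chart_source := hmem
  chart_mem_atlas p := ⟨p, rfl⟩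

/-- The transitions are ambient transitions preceded by the inclusion of `B'` and followed by `pr`;
the continuous projection makes them smooth as maps into `B'`. -/
theorem isManifold_slice :
    letI := sliceChartedSpace pr hpr he hmem
    IsManifold 𝓘(ℝ, B') ∞ {p // q p} := by
  let _ := sliceChartedSpace pr hpr he hmem
  refine isManifold_of_contDiffOn _ _ _ ?_
  rintro _ _ ⟨p, rfl⟩ ⟨p', rfl⟩
  suffices h : ContDiffOn ℝ ∞ ((he p').chart pr hpr p' ∘ ((he p).chart pr hpr p).symm)
      (((he p).chart pr hpr p).symm.trans ((he p').chart pr hpr p')).source by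
    simpa using! h
  rintro f ⟨hf1, hf2⟩
  have hf1' : (f : B) ∈ (e p).target := hf1
  have hf2' : ((((he p).chart pr hpr p).symm f : {p // q p}) : P) ∈ (e p').source := hf2
  rw [(he p).coe_chart_symm pr hpr p hf1] at hf2'
  have h1 : ContMDiffAt 𝓘(ℝ, B) 𝓘(ℝ, B) ∞ (e p).symm f :=
    contMDiffAt_symm_of_mem_maximalAtlas (he p).mem_maximalAtlas hf1'
  have h2 : ContMDiffAt 𝓘(ℝ, B) 𝓘(ℝ, B) ∞ (e p') ((e p).symm f) :=
    contMDiffAt_of_mem_maximalAtlas (he p').mem_maximalAtlas hf2'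
  have h3 : ContDiffAt ℝ ∞ (fun f : B => e p' ((e p).symm f)) f := (h2.comp _ h1).contDiffAt
  have h4 : ContDiffAt ℝ ∞ (fun f : B' => pr (e p' ((e p).symm f))) f :=
    pr.contDiff.contDiffAt.comp f (h3.comp f B'.subtypeL.contDiff.contDiffAt)
  refine (h4.congr_of_eventuallyEq ?_).contDiffWithinAt
  filter_upwards [((he p).chart pr hpr p).open_target.mem_nhds hf1] with f' hf'
  have h5 := (he p).coe_chart_symm pr hpr p hf'
  change pr (e p' _) = _
  rw [h5]

theorem contMDiff_slice_val :
    letI := sliceChartedSpace pr hpr he hmem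
    ContMDiff 𝓘(ℝ, B') 𝓘(ℝ, B) ∞ (Subtype.val : {p // q p} → P) := by
  let _ := sliceChartedSpace pr hpr he hmem
  have := isManifold_slice pr hpr he hmem
  intro p
  set κ := (he p).chart pr hpr p
  have hp : p ∈ κ.source := hmem p
  have h1 : ContMDiffAt 𝓘(ℝ, B') 𝓘(ℝ, B') ∞ κ p :=
    contMDiffAt_of_mem_maximalAtlas (IsManifold.subset_maximalAtlas ⟨p, rfl⟩) hp
  have h2 : ContMDiffAt 𝓘(ℝ, B') 𝓘(ℝ, B) ∞ B'.subtypeL (κ p) :=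
    B'.subtypeL.contDiff.contMDiff.contMDiffAt
  have h3 : ContMDiffAt 𝓘(ℝ, B) 𝓘(ℝ, B) ∞ (e p).symm (B'.subtypeL (κ p)) :=
    contMDiffAt_symm_of_mem_maximalAtlas (he p).mem_maximalAtlas (κ.map_source hp)
  refine (h3.comp p (h2.comp p h1)).congr_of_eventuallyEq ?_
  filter_upwards [κ.open_source.mem_nhds hp] with p' hp'
  have h4 := (he p).coe_chart_symm pr hpr p (κ.map_source hp')
  rwa [κ.left_inv hp'] at h4

/-- The inclusion is initial: continuity into the subspace is automatic, and in charts `f` is `pr`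
after the ambient coordinates. This yields the smooth lift in the pullback property. -/
theorem contMDiff_of_slice_val {F : Type*} [NormedAddCommGroup F] [NormedSpace ℝ F]
    {H : Type*} [TopologicalSpace H] {J : ModelWithCorners ℝ F H}
    {N : Type*} [TopologicalSpace N] [ChartedSpace H N] {f : N → {p // q p}}
    (hf : ContMDiff J 𝓘(ℝ, B) ∞ fun x => (f x : P)) :
    letI := sliceChartedSpace pr hpr he hmem
    ContMDiff J 𝓘(ℝ, B') ∞ f := by
  let _ := sliceChartedSpace pr hpr he hmem
  have := isManifold_slice pr hpr he hmem
  have hfc : Continuous f := Topology.IsInducing.subtypeVal.continuous_iff.2 hf.continuous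
  intro x
  set κ := (he (f x)).chart pr hpr (f x)
  have hp : f x ∈ κ.source := hmem (f x)
  have h1 : ContMDiffAt 𝓘(ℝ, B) 𝓘(ℝ, B) ∞ (e (f x)) (f x) :=
    contMDiffAt_of_mem_maximalAtlas (he (f x)).mem_maximalAtlas hp
  have h2 : ContMDiffAt 𝓘(ℝ, B) 𝓘(ℝ, B') ∞ pr (e (f x) (f x)) :=
    pr.contDiff.contMDiff.contMDiffAt
  have h3 : ContMDiffAt 𝓘(ℝ, B') 𝓘(ℝ, B') ∞ κ.symm (pr (e (f x) (f x))) :=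
    contMDiffAt_symm_of_mem_maximalAtlas (IsManifold.subset_maximalAtlas ⟨f x, rfl⟩)
      (κ.map_source hp)
  refine (ContMDiffAt.comp (g := κ.symm) x h3
    (ContMDiffAt.comp (g := pr) x h2 (ContMDiffAt.comp (g := e (f x)) x h1
      (hf x)))).congr_of_eventuallyEq ?_
  filter_upwards [hfc.continuousAt.eventually (κ.open_source.mem_nhds hp)] with y hy
  exact (κ.left_inv hy).symm

end Slice

/-! ### Shearing the endpoint of a path -/

section Shear

variable {E : Type v} [NormedAddCommGroup E] [NormedSpace ℝ E]

/-- The straight path from `0` to `v`. -/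
noncomputable def ramp (E : Type v) [NormedAddCommGroup E] [NormedSpace ℝ E] : E →L[ℝ] C(I, E) where
  toFun v := ⟨fun t => (t : ℝ) • v, by fun_prop⟩
  map_add' v w := by ext t; simp
  map_smul' c v := by ext t; exact smul_comm _ _ _
  cont := ContinuousMap.continuous_of_continuous_uncurry _
    (by fun_prop : Continuous fun p : E × I => (p.2 : ℝ) • p.1)

@[simp] theorem ramp_apply (v : E) (t : I) : ramp E v t = (t : ℝ) • v := rfl

/-- A projection onto the space of closed paths. -/
noncomputable def closedPathsProj (E : Type v) [NormedAddCommGroup E] [NormedSpace ℝ E] :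
    C(I, E) →L[ℝ] closedPaths E :=
  (ContinuousLinearMap.id ℝ C(I, E) + (ramp E).comp
    (ContinuousMap.evalCLM ℝ (0 : I) - ContinuousMap.evalCLM ℝ (1 : I))).codRestrict _ (by
      intro f
      change _ = _
      simp)

theorem closedPathsProj_coe (f : closedPaths E) : closedPathsProj E f = f := by
  have h : (f : C(I, E)) 0 = (f : C(I, E)) 1 := f.2
  refine Subtype.ext ?_
  ext t
  simp [closedPathsProj, h]

/-- The homeomorphism that moves `h (f 0)` to `f 0` by adding a multiple of the parameter to `f`;
it identifies the paths with `f 1 = h (f 0)` with the closed paths. -/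
noncomputable def endpointShear {h : E → E} {Ω : Set E} (hΩ : IsOpen Ω) (hh : ContinuousOn h Ω) :
    OpenPartialHomeomorph C(I, E) C(I, E) where
  toFun f := f + ramp E (f 0 - h (f 0))
  -- The ramp vanishes at time `0`, so the shear preserves `f 0` and the same correction can simply
  -- be subtracted.
  invFun f := f - ramp E (f 0 - h (f 0))
  source := {f | f 0 ∈ Ω}
  target := {f | f 0 ∈ Ω}
  map_source' f hf := by simpa using hf
  map_target' f hf := by simpa using hf
  left_inv' f hf := by simp
  right_inv' f hf := by simp
  open_source := hΩ.preimage (by fun_prop)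
  open_target := hΩ.preimage (by fun_prop)
  continuousOn_toFun := continuousOn_id.add ((ramp E).continuous.comp_continuousOn
    ((by fun_prop : Continuous fun f : C(I, E) => f 0).continuousOn.sub
      (hh.comp (by fun_prop : Continuous fun f : C(I, E) => f 0).continuousOn fun f hf => hf)))
  continuousOn_invFun := continuousOn_id.sub ((ramp E).continuous.comp_continuousOn
    ((by fun_prop : Continuous fun f : C(I, E) => f 0).continuousOn.sub
      (hh.comp (by fun_prop : Continuous fun f : C(I, E) => f 0).continuousOn fun f hf => hf)))

variable {h : E → E} {Ω : Set E} (hΩ : IsOpen Ω)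

theorem endpointShear_mem_closedPaths (hh : ContinuousOn h Ω) (f : C(I, E)) :
    endpointShear hΩ hh f ∈ closedPaths E ↔ f 1 = h (f 0) := by
  change f 0 + ramp E (f 0 - h (f 0)) 0 = f 1 + ramp E (f 0 - h (f 0)) 1 ↔ _
  simp only [ramp_apply, Set.Icc.coe_zero, Set.Icc.coe_one, zero_smul, one_smul, add_zero]
  constructor
  · intro H
    exact (sub_eq_zero.1 ((by abel : f 1 - h (f 0) = f 1 + (f 0 - h (f 0)) - f 0).trans
      (sub_eq_zero.2 H.symm)))
  · intro H
    rw [H]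
    abel

theorem contDiffOn_endpointShear (hh : ContDiffOn ℝ ∞ h Ω) :
    ContDiffOn ℝ ∞ (endpointShear hΩ hh.continuousOn) {f | f 0 ∈ Ω} := by
  have h0 : ContDiffOn ℝ ∞ (fun f : C(I, E) => f 0) {f | f 0 ∈ Ω} :=
    (ContinuousMap.evalCLM ℝ (0 : I) : C(I, E) →L[ℝ] E).contDiff.contDiffOn
  exact contDiffOn_id.add ((ramp E).contDiff.comp_contDiffOn (h0.sub (hh.comp h0 fun f hf => hf)))

theorem contDiffOn_endpointShear_symm (hh : ContDiffOn ℝ ∞ h Ω) :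
    ContDiffOn ℝ ∞ (endpointShear hΩ hh.continuousOn).symm {f | f 0 ∈ Ω} := by
  have h0 : ContDiffOn ℝ ∞ (fun f : C(I, E) => f 0) {f | f 0 ∈ Ω} :=
    (ContinuousMap.evalCLM ℝ (0 : I) : C(I, E) →L[ℝ] E).contDiff.contDiffOn
  exact contDiffOn_id.sub ((ramp E).contDiff.comp_contDiffOn (h0.sub (hh.comp h0 fun f hf => hf)))

/-- The linear version of `endpointShear`. -/
noncomputable def linearEndpointShear (h' : E →L[ℝ] E) : C(I, E) ≃L[ℝ] C(I, E) :=
  ContinuousLinearEquiv.equivOfInverse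
    (ContinuousLinearMap.id ℝ C(I, E) + ((ramp E).comp (ContinuousLinearMap.id ℝ E - h')).comp
      (ContinuousMap.evalCLM ℝ (0 : I)))
    (ContinuousLinearMap.id ℝ C(I, E) - ((ramp E).comp (ContinuousLinearMap.id ℝ E - h')).comp
      (ContinuousMap.evalCLM ℝ (0 : I)))
    (fun f => by ext t; simp) (fun f => by ext t; simp)

theorem linearEndpointShear_mem_closedPaths (h' : E →L[ℝ] E) (f : C(I, E)) :
    linearEndpointShear h' f ∈ closedPaths E ↔ f 1 = h' (f 0) :=
  endpointShear_mem_closedPaths isOpen_univ h'.continuous.continuousOn f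

theorem hasFDerivAt_endpointShear_symm (hh : ContDiffOn ℝ ∞ h Ω) {f : C(I, E)} (hf : f 0 ∈ Ω) :
    HasFDerivAt (endpointShear hΩ hh.continuousOn).symm
      ((linearEndpointShear (fderiv ℝ h (f 0))).symm : C(I, E) →L[ℝ] C(I, E)) f := by
  have h0 : HasFDerivAt (fun f : C(I, E) => f 0)
      (ContinuousMap.evalCLM ℝ (0 : I) : C(I, E) →L[ℝ] E) f :=
    (ContinuousMap.evalCLM ℝ (0 : I) : C(I, E) →L[ℝ] E).hasFDerivAt
  have h1 : HasFDerivAt h (fderiv ℝ h (f 0)) (f 0) :=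
    ((hh.contDiffAt (hΩ.mem_nhds hf)).differentiableAt (by simp)).hasFDerivAt
  exact (hasFDerivAt_id f).sub ((ramp E).hasFDerivAt.comp f (h0.sub (h1.comp f h0)))

end Shear

/-! ### Slice charts of the twisted loop space -/

section TwistedLoops

variable {E : Type v} [NormedAddCommGroup E] [NormedSpace ℝ E] [FiniteDimensional ℝ E]
  {M : Type u} [TopologicalSpace M] [ChartedSpace E M] [IsManifold 𝓘(ℝ, E) ∞ M]
  {γ : C(I, M)} (α : LocalAddition E M) (A : FrameAlong E M γ) (φ : M → M)

namespace LocalAddition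

/-- The map `φ`, read in the charts `LocalAddition.kernel α A` at the endpoints. -/
noncomputable def twist (v : E) : E := α.kernelInv A (1, φ (α.kernel A (0, v)))

/-- The domain of `LocalAddition.twist`. -/
def twistDomain : Set E :=
  {v | A.lift (0, v) ∈ α.toHomeo.source ∧ (γ 1, φ (α.kernel A (0, v))) ∈ α.toHomeo.target}

variable {φ} (hφ : ContMDiff 𝓘(ℝ, E) 𝓘(ℝ, E) ∞ φ)

include hφ

omit [FiniteDimensional ℝ E] in
theorem isOpen_twistDomain : IsOpen (α.twistDomain A φ) := by
  rw [isOpen_iff_mem_nhds]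
  rintro v ⟨h1, h2⟩
  have h3 : ContinuousAt (fun v : E => ((0 : I), v)) v := by fun_prop
  have h4 : ContinuousAt (fun v => (γ 1, φ (α.kernel A (0, v)))) v :=
    continuousAt_const.prodMk (ContinuousAt.comp (g := φ) hφ.continuous.continuousAt
      (ContinuousAt.comp (g := α.kernel A) (α.continuousAt_kernel A h1) h3))
  filter_upwards [(ContinuousAt.comp (g := A.lift) A.continuous_lift.continuousAt h3).eventually
    (α.toHomeo.open_source.mem_nhds h1), h4.eventually (α.toHomeo.open_target.mem_nhds h2)]
    with v' h5 h6
  exact ⟨h5, h6⟩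

theorem contDiffOn_twist : ContDiffOn ℝ ∞ (α.twist A φ) (α.twistDomain A φ) := by
  rintro v ⟨h1, h2⟩
  refine ContDiffAt.contDiffWithinAt ?_
  have h3 : ContMDiffAt 𝓘(ℝ, E) 𝓘(ℝ, E) ∞ (fun v => φ (α.kernel A (0, v))) v :=
    ContMDiffAt.comp v (g := φ) hφ.contMDiffAt (α.paramSmoothAt_kernel A h1).contMDiffAt_slice
  -- The map is regarded as constant in the path parameter, so that the fibrewise inverse can be
  -- applied at parameter `1`.
  have h4 : ParamSmoothAt 𝓘(ℝ, E) (fun w : I × E => φ (α.kernel A (0, w.2))) (1, v) := by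
    refine (ParamSmoothAt.snd (1, v)).comp (f := fun v => φ (α.kernel A (0, v))) ?_
    filter_upwards [(α.isOpen_twistDomain A hφ).mem_nhds ⟨h1, h2⟩] with v' h5
    exact ContMDiffAt.comp v' (g := φ) hφ.contMDiffAt
      (α.paramSmoothAt_kernel A h5.1).contMDiffAt_slice
  exact (α.paramSmoothAt_kernelInv A h4 h2).contMDiffAt_slice.contDiffAt

/-- The slice chart for the twisted loop space induced by a path chart. -/
noncomputable def twistChart (e : OpenPartialHomeomorph C(I, M) C(I, E)) :
    OpenPartialHomeomorph C(I, M) C(I, E) :=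
  e.trans (endpointShear (α.isOpen_twistDomain A hφ) (α.contDiffOn_twist A hφ).continuousOn)

end LocalAddition

variable {α A φ}

namespace IsPathChartOf

variable {e : OpenPartialHomeomorph C(I, M) C(I, E)} (he : IsPathChartOf α A e)

include he

omit [FiniteDimensional ℝ E] in
theorem mem_twistDomain {η : C(I, M)} (h : η ∈ e.source) (hη : η 1 = φ (η 0)) :
    e η 0 ∈ α.twistDomain A φ := by
  have h1 := he.symm_apply _ (e.map_source h) 0
  rw [e.left_inv h] at h1
  refine ⟨he.lift_mem (e.map_source h) 0, ?_⟩
  rw [← h1, ← hη]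
  exact he.mem_target h 1

-- At parameter `1` the fibrewise inverse kernel is injective on the points it is defined for;
-- `twistDomain` ensures that `φ (η 0)` is one of them.
omit [FiniteDimensional ℝ E] in
theorem twist_iff {η : C(I, M)} (h : η ∈ e.source) (h' : e η 0 ∈ α.twistDomain A φ) :
    η 1 = φ (η 0) ↔ e η 1 = α.twist A φ (e η 0) := by
  have h1 := he.symm_apply _ (e.map_source h) 0
  rw [e.left_inv h] at h1
  rw [LocalAddition.twist, he.apply_eq h 1, ← h1]
  constructor
  · intro H
    rw [H]
  · intro H
    have h2 := h'.2
    rw [← h1] at h2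
    rw [← α.kernel_kernelInv A (he.mem_target h 1), H, α.kernel_kernelInv A h2]

theorem isSliceChart_twistChart [ChartedSpace C(I, E) C(I, M)]
    [IsManifold 𝓘(ℝ, C(I, E)) ∞ C(I, M)] (hφ : ContMDiff 𝓘(ℝ, E) 𝓘(ℝ, E) ∞ φ)
    (hm : e ∈ IsManifold.maximalAtlas 𝓘(ℝ, C(I, E)) ∞ C(I, M)) :
    IsSliceChart (fun η => η 1 = φ (η 0)) (closedPaths E) (α.twistChart A hφ e) where
  mem_maximalAtlas := by
    have h1 : ContMDiffOn 𝓘(ℝ, C(I, E)) 𝓘(ℝ, C(I, E)) ∞ (α.twistChart A hφ e)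
        (α.twistChart A hφ e).source :=
      (contDiffOn_endpointShear (α.isOpen_twistDomain A hφ)
        (α.contDiffOn_twist A hφ)).contMDiffOn.comp
        ((contMDiffOn_of_mem_maximalAtlas hm).mono fun η hη => hη.1) fun η hη => hη.2
    have h2 : ContMDiffOn 𝓘(ℝ, C(I, E)) 𝓘(ℝ, C(I, E)) ∞ (α.twistChart A hφ e).symm
        (α.twistChart A hφ e).target :=
      (contMDiffOn_symm_of_mem_maximalAtlas hm).comp
        ((contDiffOn_endpointShear_symm (α.isOpen_twistDomain A hφ)
          (α.contDiffOn_twist A hφ)).contMDiffOn.mono fun f hf => hf.1) fun f hf => hf.2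
    exact OpenPartialHomeomorph.mem_maximalAtlas_of_contMDiffOn _ h1 h2
  mem_iff η hη := by
    rw [he.twist_iff hη.1 hη.2]
    exact (endpointShear_mem_closedPaths (α.isOpen_twistDomain A hφ)
      (α.contDiffOn_twist A hφ).continuousOn (e η)).symm

end IsPathChartOf

end TwistedLoops

/-! ### Morphisms of Banach manifolds -/

namespace BanachMfd

/-- The morphism of Banach manifolds given by a smooth map. -/
noncomputable def homMk {X Y : BanachMfd.{u, v}} (f : X.carrier → Y.carrier)
    (hf : ContMDiff 𝓘(ℝ, X.model) 𝓘(ℝ, Y.model) ∞ f) : X ⟶ Y :=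
  (⟨f, hf⟩ : C^∞⟮𝓘(ℝ, X.model), X.carrier; 𝓘(ℝ, Y.model), Y.carrier⟯)

variable {X Y Z : BanachMfd.{u, v}}

theorem contMDiff_map (f : X ⟶ Y) : ContMDiff 𝓘(ℝ, X.model) 𝓘(ℝ, Y.model) ∞ (Hom.map f) :=
  (show C^∞⟮𝓘(ℝ, X.model), X.carrier; 𝓘(ℝ, Y.model), Y.carrier⟯ from f).contMDiff

theorem hom_ext {f g : X ⟶ Y} (h : ∀ x, Hom.map f x = Hom.map g x) : f = g :=
  DFunLike.ext (F := C^∞⟮𝓘(ℝ, X.model), X.carrier; 𝓘(ℝ, Y.model), Y.carrier⟯) f g h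

@[simp] theorem map_comp (f : X ⟶ Y) (g : Y ⟶ Z) (x : X.carrier) :
    Hom.map (CategoryTheory.CategoryStruct.comp f g) x = Hom.map g (Hom.map f x) := rfl

theorem contMDiff_prodMk {f : X.carrier → Y.carrier} {g : X.carrier → Z.carrier}
    (hf : ContMDiff 𝓘(ℝ, X.model) 𝓘(ℝ, Y.model) ∞ f)
    (hg : ContMDiff 𝓘(ℝ, X.model) 𝓘(ℝ, Z.model) ∞ g) :
    ContMDiff (M' := (Y.prod Z).carrier) 𝓘(ℝ, X.model) 𝓘(ℝ, (Y.prod Z).model) ∞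
      (fun x => (f x, g x)) := by
  have h := hf.prodMk hg
  rw [← modelWithCornersSelf_prod] at h
  exact h

/-- A square of Banach manifolds whose left upper corner is an initial submanifold of the right
upper corner, and set-theoretically the preimage of the graph of a map, is a pullback. -/
theorem isPullback_of_graph {L P N : BanachMfd.{u, v}} {incl : L ⟶ P} {ev : L ⟶ N}
    {ends : P ⟶ N.prod N} {graph : N ⟶ N.prod N} {a b : P.carrier → N.carrier}
    {φ : N.carrier → N.carrier}
    (hinj : Function.Injective (Hom.map incl))
    (hev : ∀ x, Hom.map ev x = a (Hom.map incl x))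
    (hends : ∀ x, Hom.map ends x = (a x, b x)) (hgraph : ∀ x, Hom.map graph x = (x, φ x))
    (hL : ∀ x, b (Hom.map incl x) = φ (a (Hom.map incl x)))
    (hlift : ∀ (Q : BanachMfd.{u, v}) (f : Q ⟶ P),
      (∀ x, b (Hom.map f x) = φ (a (Hom.map f x))) → ∃ g : Q ⟶ L, CategoryTheory.CategoryStruct.comp g incl = f) :
    CategoryTheory.IsPullback incl ev ends graph := by
  have hw : CategoryTheory.CategoryStruct.comp incl ends =
      CategoryTheory.CategoryStruct.comp ev graph := by
    refine hom_ext fun x => ?_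
    rw [map_comp, map_comp, hends, hgraph, hev, hL]
  have key : ∀ s : CategoryTheory.Limits.PullbackCone ends graph, ∀ x,
      a (Hom.map s.fst x) = Hom.map s.snd x ∧ b (Hom.map s.fst x) = φ (Hom.map s.snd x) := by
    intro s x
    have h := congrArg (fun f => Hom.map f x) s.condition
    simp only [map_comp, hends, hgraph] at h
    exact Prod.mk.inj h
  have h1 : ∀ s : CategoryTheory.Limits.PullbackCone ends graph, ∃ g : s.pt ⟶ L,
      CategoryTheory.CategoryStruct.comp g incl = s.fst := fun s =>
    hlift _ s.fst fun x => by rw [(key s x).2, (key s x).1]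
  choose lift hl using h1
  refine ⟨⟨hw⟩, ⟨CategoryTheory.Limits.PullbackCone.IsLimit.mk hw lift hl (fun s => ?_)
    (fun s m h _ => ?_)⟩⟩
  · refine hom_ext fun x => ?_
    rw [map_comp, hev, ← (key s x).1, ← hl s, map_comp]
  · refine hom_ext fun x => hinj ?_
    have h2 := congrArg (fun f => Hom.map f x) (h.trans (hl s).symm)
    exact h2

end BanachMfd

/-! ### Derivatives of parametrically smooth maps -/

section ParamTangent

variable {T : Type*} [TopologicalSpace T] {E : Type v} [NormedAddCommGroup E] [NormedSpace ℝ E]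
  {F : Type*} [NormedAddCommGroup F] [NormedSpace ℝ F] {H : Type*} [TopologicalSpace H]
  {J : ModelWithCorners ℝ F H} {N : Type*} [TopologicalSpace N] [ChartedSpace H N]
  [IsManifold J ∞ N]

theorem ContMDiffAt.continuousAt_tangentMap {F' : Type*} [NormedAddCommGroup F'] [NormedSpace ℝ F']
    {G : F' → N} {y : F'} (hG : ∀ᶠ y' in 𝓝 y, ContMDiffAt 𝓘(ℝ, F') J ∞ G y') (w : F') :
    ContinuousAt (tangentMap 𝓘(ℝ, F') J G) (⟨y, w⟩ : TangentBundle 𝓘(ℝ, F') F') := by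
  obtain ⟨U, hU, hUo, hy⟩ := eventually_nhds_iff.1 hG
  have h1 : IsManifold J 1 N := .of_le (n := ∞) (by simp)
  have h2 : ContinuousOn (tangentMapWithin 𝓘(ℝ, F') J G U)
      (Bundle.TotalSpace.proj (F := F') (E := (TangentSpace 𝓘(ℝ, F') : F' → Type _)) ⁻¹' U) :=
    ContMDiffOn.continuousOn_tangentMapWithin (n := ∞)
      (fun y' hy' => (hU y' hy').contMDiffWithinAt) (by simp) hUo.uniqueMDiffOn
  have hV : (Bundle.TotalSpace.proj (F := F') (E := (TangentSpace 𝓘(ℝ, F') : F' → Type _)) ⁻¹' U)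
      ∈ 𝓝 (⟨y, w⟩ : TangentBundle 𝓘(ℝ, F') F') :=
    (hUo.preimage (FiberBundle.continuous_proj F' _)).mem_nhds hy
  refine (h2.continuousAt hV).congr ?_
  filter_upwards [hV] with ξ hξ
  exact tangentMapWithin_eq_tangentMap (hUo.uniqueMDiffOn _ hξ)
    ((hU _ hξ).mdifferentiableAt (by simp))

/-- Writing `g` as `G (c t, v)`, the value is the tangent map of `G` on the vector `(0, w)` at `(c
t, f t)`. Thus `c` is never differentiated and its continuity suffices. -/
theorem ParamSmoothAt.continuousAt_tangentMap {g : T × E → N} {f : T → E} {t₀ : T}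
    (hf : ContinuousAt f t₀) (hg : ParamSmoothAt J g (t₀, f t₀)) (w₀ : E) :
    ContinuousAt (fun p : T × E => tangentMap 𝓘(ℝ, E) J (fun v => g (p.1, v))
      (⟨f p.1, p.2⟩ : TangentBundle 𝓘(ℝ, E) E)) (t₀, w₀) := by
  obtain ⟨Q, i1, i2, c, G, hc, hG, hgG⟩ := hg
  have hf' : ContinuousAt (fun p : T × E => f p.1) (t₀, w₀) :=
    ContinuousAt.comp (g := f) hf continuousAt_fst
  have hc' : ContinuousAt (fun p : T × E => c p.1) (t₀, w₀) :=
    ContinuousAt.comp (g := c) hc.self_of_nhds continuousAt_fst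
  have h1 : ContinuousAt (fun p : T × E =>
      (⟨(c p.1, f p.1), (0, p.2)⟩ : TangentBundle 𝓘(ℝ, Q × E) (Q × E))) (t₀, w₀) := by
    refine ContinuousAt.comp (g := (tangentBundleModelSpaceHomeomorph 𝓘(ℝ, Q × E)).symm)
      (f := fun p : T × E => ((c p.1, f p.1), ((0 : Q), p.2)))
      (Homeomorph.continuous _).continuousAt ?_
    exact (hc'.prodMk hf').prodMk (continuousAt_const.prodMk continuousAt_snd)
  have h1' : ContinuousAt (tangentMap 𝓘(ℝ, Q × E) J G)
      (⟨(c t₀, f t₀), (0, w₀)⟩ : TangentBundle 𝓘(ℝ, Q × E) (Q × E)) :=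
    ContMDiffAt.continuousAt_tangentMap hG ((0 : Q), w₀)
  refine (ContinuousAt.comp (g := tangentMap 𝓘(ℝ, Q × E) J G) (f := fun p : T × E =>
    (⟨(c p.1, f p.1), (0, p.2)⟩ : TangentBundle 𝓘(ℝ, Q × E) (Q × E))) h1' h1).congr ?_
  have h2 : Tendsto (fun p : T × E => (p.1, f p.1)) (𝓝 (t₀, w₀)) (𝓝 (t₀, f t₀)) :=
    continuousAt_fst.prodMk hf'
  filter_upwards [h2.eventually hgG.eventually_nhds, (hc'.prodMk hf').eventually hG] with p h3 h4
  have h5 : (fun v => g (p.1, v)) =ᶠ[𝓝 (f p.1)] fun v => G (c p.1, v) :=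
    ((Continuous.prodMk_right p.1).tendsto (f p.1)).eventually h3
  have h6 : HasMFDerivAt 𝓘(ℝ, E) 𝓘(ℝ, Q × E) (fun v : E => (c p.1, v)) (f p.1)
      (ContinuousLinearMap.inr ℝ Q E) := (hasFDerivAt_prodMk_right (c p.1) (f p.1)).hasMFDerivAt
  have h7 := (HasMFDerivAt.comp (g := G) (f p.1)
    (h4.mdifferentiableAt (by simp)).hasMFDerivAt h6).congr_of_eventuallyEq h5
  have h8 := h5.self_of_nhds
  simp only [tangentMap]
  rw [h7.mfderiv]
  exact (congrArg (fun x => (⟨x, mfderiv 𝓘(ℝ, Q × E) J G (c p.1, f p.1) (0, p.2)⟩ :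
    TangentBundle J N)) h8).symm

end ParamTangent

/-! ### Sections of the tangent bundle along a path -/

section TangentSections

variable {E : Type v} [NormedAddCommGroup E] [NormedSpace ℝ E]
  {M : Type u} [TopologicalSpace M] [ChartedSpace E M] [IsManifold 𝓘(ℝ, E) ∞ M]
  {γ : C(I, M)}

namespace FrameAlong

/-- The section along `γ` with given coordinates. -/
noncomputable def sec (A : FrameAlong E M γ) (f : C(I, E)) : C(I, TangentBundle 𝓘(ℝ, E) M) :=
  ⟨fun t => A.lift (t, f t), A.continuous_lift.comp (by fun_prop)⟩

theorem range_sec [FiniteDimensional ℝ E] (A : FrameAlong E M γ) :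
    Set.range A.sec = {X | ∀ t, (X t).proj = γ t} := by
  refine Set.Subset.antisymm ?_ fun X hX => ?_
  · rintro _ ⟨f, rfl⟩ t
    rfl
  · refine ⟨⟨fun t => A.coord t (X t), ?_⟩, ?_⟩
    · rw [continuous_iff_continuousAt]
      exact fun t => A.continuousAt_coord continuousAt_id X.continuous.continuousAt (.of_forall hX)
    · ext1 t
      exact A.lift_coord (hX t)

/-- On the subspace of sections along `γ`, taking coordinates is a left inverse, continuous for the
compact-open topology. -/
theorem isEmbedding_sec [FiniteDimensional ℝ E] (A : FrameAlong E M γ) :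
    IsEmbedding A.sec := by
  let Z := {X : C(I, TangentBundle 𝓘(ℝ, E) M) // ∀ t, (X t).proj = γ t}
  have h1 : Continuous A.sec := ContinuousMap.continuous_of_continuous_uncurry _
    (A.continuous_lift.comp (by fun_prop : Continuous fun p : C(I, E) × I => (p.2, p.1 p.2)))
  have h2 : Continuous fun p : Z × I => A.coord p.2 (p.1.1 p.2) := by
    rw [continuous_iff_continuousAt]
    intro p
    have h3 : Continuous fun p : Z × I => p.1.1 p.2 :=
      (continuous_subtype_val.comp continuous_fst).eval continuous_snd
    exact A.continuousAt_coord continuousAt_snd h3.continuousAt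
      (.of_forall fun q => q.1.2 q.2)
  let Φ : C(I, E) → Z := fun f => ⟨A.sec f, fun t => rfl⟩
  let Ψ : Z → C(I, E) := ContinuousMap.curry ⟨_, h2⟩
  have h3 : Function.LeftInverse Ψ Φ := fun f => by
    ext t
    exact A.coord_lift (t, f t)
  exact IsEmbedding.subtypeVal.comp
    (h3.isEmbedding (ContinuousMap.curry _).continuous (h1.subtype_mk _))

end FrameAlong

variable [FiniteDimensional ℝ E] (α : LocalAddition E M) (A : FrameAlong E M γ)

namespace LocalAddition

theorem contMDiffAt_kernelInv {t : I} {y : M} (h : (γ t, y) ∈ α.toHomeo.target) :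
    ContMDiffAt 𝓘(ℝ, E) 𝓘(ℝ, E) ∞ (fun y => α.kernelInv A (t, y)) y := by
  set ψ := extChartAt 𝓘(ℝ, E) y
  have hψ : ψ.symm (ψ y) = y := extChartAt_to_inv y
  have h1 : ParamSmoothAt 𝓘(ℝ, E) (fun w : I × E => ψ.symm w.2) (t, ψ y) := by
    have hT : ψ.target ∈ 𝓝 (ψ y) := extChartAt_target_mem_nhds y
    refine (ParamSmoothAt.snd (t, ψ y)).comp (f := ψ.symm) ?_
    filter_upwards [eventually_mem_nhds_iff.2 hT]
      with v hv
    exact (contMDiffOn_extChartAt_symm y).contMDiffAt hv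
  have h2 := (α.paramSmoothAt_kernelInv A h1 (by simpa only [hψ] using h)).contMDiffAt_slice
  refine (ContMDiffAt.comp (g := fun v => α.kernelInv A (t, ψ.symm v)) y h2
    contMDiffAt_extChartAt).congr_of_eventuallyEq ?_
  have hS : ψ.source ∈ 𝓝 y := extChartAt_source_mem_nhds y
  filter_upwards [hS] with y' hy'
  exact congrArg (fun z => α.kernelInv A (t, z)) (ψ.left_inv hy').symm

/-- The fibrewise inverse kernel is a smooth left inverse near `v`. Injectivity suffices for a
frame, source and target having the same finite dimension. -/
theorem mfderiv_kernel_injective {t : I} {v : E} (h : A.lift (t, v) ∈ α.toHomeo.source) :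
    Function.Injective (mfderiv 𝓘(ℝ, E) 𝓘(ℝ, E) (fun v => α.kernel A (t, v)) v) := by
  have h1 : MDifferentiableAt 𝓘(ℝ, E) 𝓘(ℝ, E) (fun v => α.kernel A (t, v)) v :=
    (α.paramSmoothAt_kernel A h).contMDiffAt_slice.mdifferentiableAt (by simp)
  have h2 : MDifferentiableAt 𝓘(ℝ, E) 𝓘(ℝ, E) (fun y => α.kernelInv A (t, y)) (α.kernel A (t, v)) :=
    (α.contMDiffAt_kernelInv A (α.kernel_mem_target A h)).mdifferentiableAt (by simp)
  have h3 := (HasMFDerivAt.comp (g := fun y => α.kernelInv A (t, y)) v h2.hasMFDerivAt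
    h1.hasMFDerivAt)
  have h4 : HasMFDerivAt 𝓘(ℝ, E) 𝓘(ℝ, E)
      ((fun y => α.kernelInv A (t, y)) ∘ fun v => α.kernel A (t, v)) v
      (ContinuousLinearMap.id ℝ E) := by
    refine (hasMFDerivAt_id v).congr_of_eventuallyEq ?_
    filter_upwards [(α.toHomeo.open_source.preimage
      (A.continuous_lift.comp (Continuous.prodMk_right t))).mem_nhds h] with v' hv'
    exact α.kernelInv_kernel A hv'
  have h5 := hasMFDerivAt_unique h3 h4
  intro w w' hw
  have h6 := fun w => DFunLike.congr_fun h5 w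
  exact (h6 w).symm.trans ((congrArg _ hw).trans (h6 w'))

end LocalAddition

namespace IsPathChartOf

variable {α A} {e : OpenPartialHomeomorph C(I, M) C(I, E)} (he : IsPathChartOf α A e)
  {η : C(I, M)} (hη : η ∈ e.source)

include he hη

omit [FiniteDimensional ℝ E] in
theorem kernel_apply (t : I) : α.kernel A (t, e η t) = η t := by
  rw [← he.symm_apply _ (e.map_source hη), e.left_inv hη]

/-- The derivative of the kernel along a path, as a frame along this path. -/
noncomputable def frame : FrameAlong E M η where
  equiv t := (LinearEquiv.ofInjectiveEndo
    ((show E →L[ℝ] E from mfderiv 𝓘(ℝ, E) 𝓘(ℝ, E) (fun v => α.kernel A (t, v)) (e η t)) : E →ₗ[ℝ] E)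
    (α.mfderiv_kernel_injective A (he.lift_mem (e.map_source hη) t))).toContinuousLinearEquiv
  continuous := by
    rw [continuous_iff_continuousAt]
    rintro ⟨t, w⟩
    refine (ParamSmoothAt.continuousAt_tangentMap (e η).continuous.continuousAt
      (α.paramSmoothAt_kernel A (he.lift_mem (e.map_source hη) t)) w).congr (.of_forall fun p => ?_)
    exact congrArg (fun x => (⟨x, mfderiv 𝓘(ℝ, E) 𝓘(ℝ, E) (fun v => α.kernel A (p.1, v))
      (e η p.1) p.2⟩ : TangentBundle 𝓘(ℝ, E) M)) (he.kernel_apply hη p.1)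

theorem frame_lift_eq (t : I) (w : E) : (he.frame hη).lift (t, w) =
    tangentMap 𝓘(ℝ, E) 𝓘(ℝ, E) (fun v => α.kernel A (t, v)) ⟨e η t, w⟩ :=
  (congrArg (fun x => (⟨x, mfderiv 𝓘(ℝ, E) 𝓘(ℝ, E) (fun v => α.kernel A (t, v))
      (e η t) w⟩ : TangentBundle 𝓘(ℝ, E) M)) (he.kernel_apply hη t)).symm

/-- Chain rule for `φ ∘ k (0, ·) = k (1, ·) ∘ twist`, with `k` the kernel. It translates the
linearised endpoint condition from coordinates to tangent vectors. -/
theorem tangentMap_frame_lift {φ : M → M} (hφ : ContMDiff 𝓘(ℝ, E) 𝓘(ℝ, E) ∞ φ)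
    (h : η 1 = φ (η 0)) (w : E) :
    tangentMap 𝓘(ℝ, E) 𝓘(ℝ, E) φ ((he.frame hη).lift (0, w)) =
      (he.frame hη).lift (1, fderiv ℝ (α.twist A φ) (e η 0) w) := by
  have h0 := he.mem_twistDomain hη h
  have hl := fun t => he.lift_mem (e.map_source hη) t
  have ha : ∀ t, MDifferentiableAt 𝓘(ℝ, E) 𝓘(ℝ, E) (fun v => α.kernel A (t, v)) (e η t) :=
    fun t => (α.paramSmoothAt_kernel A (hl t)).contMDiffAt_slice.mdifferentiableAt (by simp)
  have ht : MDifferentiableAt 𝓘(ℝ, E) 𝓘(ℝ, E) (α.twist A φ) (e η 0) :=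
    (((α.contDiffOn_twist A hφ).contDiffAt ((α.isOpen_twistDomain A hφ).mem_nhds h0)
      ).differentiableAt (by simp)).mdifferentiableAt
  have he1 : α.twist A φ (e η 0) = e η 1 := ((he.twist_iff hη h0).1 h).symm
  have ha1 : MDifferentiableAt 𝓘(ℝ, E) 𝓘(ℝ, E) (fun v => α.kernel A (1, v))
      (α.twist A φ (e η 0)) := by
    rw [he1]
    exact ha 1
  have hE : φ ∘ (fun v => α.kernel A (0, v)) =ᶠ[𝓝 (e η 0)]
      (fun v => α.kernel A (1, v)) ∘ α.twist A φ := by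
    filter_upwards [(α.isOpen_twistDomain A hφ).mem_nhds h0] with v hv
    exact (α.kernel_kernelInv A hv.2).symm
  have h1 := HasMFDerivAt.comp (g := φ) (e η 0) (hφ.mdifferentiableAt (by simp)).hasMFDerivAt
    (ha 0).hasMFDerivAt
  have h2 := (HasMFDerivAt.comp (g := fun v => α.kernel A (1, v)) (e η 0) ha1.hasMFDerivAt
    ht.hasMFDerivAt).congr_of_eventuallyEq hE
  have h3 := DFunLike.congr_fun (hasMFDerivAt_unique h1 h2) w
  rw [he.frame_lift_eq hη, he.frame_lift_eq hη, ← he1, ← mfderiv_eq_fderiv]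
  exact (congrArg (Bundle.TotalSpace.mk (φ (α.kernel A (0, e η 0)))) h3).trans
    (congrArg (fun x => (⟨x, mfderiv 𝓘(ℝ, E) 𝓘(ℝ, E) (fun v => α.kernel A (1, v))
      (α.twist A φ (e η 0)) (mfderiv 𝓘(ℝ, E) 𝓘(ℝ, E) (α.twist A φ) (e η 0) w)⟩ :
      TangentBundle 𝓘(ℝ, E) M)) hE.self_of_nhds)

end IsPathChartOf

end TangentSections

/-! ### The tangent spaces of the twisted loop space -/

theorem exists_hasMFDerivAt_of_mem_maximalAtlas {F : Type*} [NormedAddCommGroup F]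
    [NormedSpace ℝ F] {L : Type*} [TopologicalSpace L] [ChartedSpace F L]
    [IsManifold 𝓘(ℝ, F) ∞ L] {κ : OpenPartialHomeomorph L F}
    (hκ : κ ∈ IsManifold.maximalAtlas 𝓘(ℝ, F) ∞ L) {x : L} (hx : x ∈ κ.source) :
    ∃ J : TangentSpace 𝓘(ℝ, F) x ≃L[ℝ] F,
      HasMFDerivAt 𝓘(ℝ, F) 𝓘(ℝ, F) κ x (J : TangentSpace 𝓘(ℝ, F) x →L[ℝ] F) := by
  have hκd : κ.MDifferentiable 𝓘(ℝ, F) 𝓘(ℝ, F) :=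
    ⟨(contMDiffOn_of_mem_maximalAtlas hκ).mdifferentiableOn (by simp),
      (contMDiffOn_symm_of_mem_maximalAtlas hκ).mdifferentiableOn (by simp)⟩
  exact ⟨hκd.mfderiv hx, (hκd.mdifferentiableAt hx).hasMFDerivAt⟩

/-- The derivative of a map that becomes a chart with values in the closed paths after shearing. -/
theorem exists_hasMFDerivAt_of_endpointShear {E : Type v} [NormedAddCommGroup E] [NormedSpace ℝ E]
    {L : Type*} [TopologicalSpace L] [ChartedSpace (closedPaths E) L]
    [IsManifold 𝓘(ℝ, closedPaths E) ∞ L] {κ : OpenPartialHomeomorph L (closedPaths E)}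
    (hκ : κ ∈ IsManifold.maximalAtlas 𝓘(ℝ, closedPaths E) ∞ L)
    {h : E → E} {Ω : Set E} (hΩ : IsOpen Ω) (hh : ContDiffOn ℝ ∞ h Ω) {g : L → C(I, E)}
    (hg : ∀ p ∈ κ.source, g p 0 ∈ Ω)
    (hκg : ∀ p ∈ κ.source, (κ p : C(I, E)) = endpointShear hΩ hh.continuousOn (g p))
    {x : L} (hx : x ∈ κ.source) :
    ∃ G : TangentSpace 𝓘(ℝ, closedPaths E) x →L[ℝ] C(I, E),
      HasMFDerivAt 𝓘(ℝ, closedPaths E) 𝓘(ℝ, C(I, E)) g x G ∧ IsEmbedding G ∧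
      ∀ f : C(I, E), f ∈ Set.range G ↔ f 1 = fderiv ℝ h (g x 0) (f 0) := by
  obtain ⟨J, hJ⟩ := exists_hasMFDerivAt_of_mem_maximalAtlas hκ hx
  set h' := fderiv ℝ h (g x 0)
  have hgκ : ∀ p ∈ κ.source, (endpointShear hΩ hh.continuousOn).symm (κ p : C(I, E)) = g p := by
    intro p hp
    rw [hκg p hp]
    exact (endpointShear hΩ hh.continuousOn).left_inv (hg p hp)
  have h0 : (κ x : C(I, E)) 0 = g x 0 := by
    rw [← hgκ x hx]
    change _ = (κ x : C(I, E)) 0 - ramp E _ 0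
    simp
  -- Near `x` the map `g` is the chart, then the inclusion of the closed paths, then the inverse
  -- shear. Its derivative is therefore an isomorphism, a subspace inclusion and an isomorphism,
  -- which gives both the embedding and the range.
  let D : closedPaths E →L[ℝ] C(I, E) :=
    ((linearEndpointShear h').symm : C(I, E) →L[ℝ] C(I, E)).comp (closedPaths E).subtypeL
  have hD : HasFDerivAt (fun f : closedPaths E => (endpointShear hΩ hh.continuousOn).symm f) D
      (κ x) := by
    have h1 := hasFDerivAt_endpointShear_symm hΩ hh (f := κ x) (by rw [h0]; exact hg x hx)
    rw [h0] at h1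
    exact h1.comp (κ x) (closedPaths E).subtypeL.hasFDerivAt
  refine ⟨D.comp (J : TangentSpace 𝓘(ℝ, closedPaths E) x →L[ℝ] closedPaths E), ?_, ?_, fun f => ?_⟩
  · refine (HasMFDerivAt.comp (g := fun f : closedPaths E =>
      (endpointShear hΩ hh.continuousOn).symm f) x hD.hasMFDerivAt hJ).congr_of_eventuallyEq ?_
    filter_upwards [κ.open_source.mem_nhds hx] with p hp
    exact (hgκ p hp).symm
  · exact (linearEndpointShear h').symm.toHomeomorph.isEmbedding.comp
      (IsEmbedding.subtypeVal.comp J.toHomeomorph.isEmbedding)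
  · rw [← linearEndpointShear_mem_closedPaths]
    constructor
    · rintro ⟨ξ, rfl⟩
      change linearEndpointShear h' ((linearEndpointShear h').symm (J ξ : C(I, E))) ∈ _
      rw [ContinuousLinearEquiv.apply_symm_apply]
      exact (J ξ).2
    · intro hf
      refine ⟨J.symm ⟨_, hf⟩, ?_⟩
      change (linearEndpointShear h').symm (J (J.symm ⟨_, hf⟩) : C(I, E)) = f
      rw [ContinuousLinearEquiv.apply_symm_apply, ContinuousLinearEquiv.symm_apply_apply]

section TwistedTangent

variable {E : Type v} [NormedAddCommGroup E] [NormedSpace ℝ E] [FiniteDimensional ℝ E]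
  {M : Type u} [TopologicalSpace M] [ChartedSpace E M] [IsManifold 𝓘(ℝ, E) ∞ M]
  {γ : C(I, M)} {α : LocalAddition E M} {A : FrameAlong E M γ} {φ : M → M}
  {e : OpenPartialHomeomorph C(I, M) C(I, E)}

/-- The map is `ξ ↦ B.sec (G ξ)`, with `B` the frame of kernel derivatives along `η` and `G` the
derivative of the path chart on the loop space. Both factors are embeddings, and `B` intertwines the
derivative of the twist with `Dφ`. -/
theorem IsPathChartOf.exists_tangent_isEmbedding (he : IsPathChartOf α A e)
    (hφ : ContMDiff 𝓘(ℝ, E) 𝓘(ℝ, E) ∞ φ)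
    [ChartedSpace (closedPaths E) (TwistedLoopSpace φ)]
    [IsManifold 𝓘(ℝ, closedPaths E) ∞ (TwistedLoopSpace φ)]
    {κ : OpenPartialHomeomorph (TwistedLoopSpace φ) (closedPaths E)}
    (hκ : κ ∈ IsManifold.maximalAtlas 𝓘(ℝ, closedPaths E) ∞ (TwistedLoopSpace φ))
    (hs : ∀ p ∈ κ.source, p.1 ∈ e.source)
    (hcoe : ∀ p ∈ κ.source, (κ p : C(I, E)) = α.twistChart A hφ e p)
    {η : TwistedLoopSpace φ} (hη : η ∈ κ.source) :
    ∃ Θ : TangentSpace 𝓘(ℝ, closedPaths E) η → C(I, TangentBundle 𝓘(ℝ, E) M),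
      (∀ ξ t, Θ ξ t = ⟨η.1 t, mfderiv 𝓘(ℝ, closedPaths E) 𝓘(ℝ, E)
        (fun η' : TwistedLoopSpace φ => η'.1 t) η ξ⟩) ∧
      Topology.IsEmbedding Θ ∧
      Set.range Θ = {X | (∀ t, (X t).proj = η.1 t) ∧
        X 1 = tangentMap 𝓘(ℝ, E) 𝓘(ℝ, E) φ (X 0)} := by
  have hηe : η.1 ∈ e.source := hs η hη
  obtain ⟨G, hG, hGe, hGr⟩ := exists_hasMFDerivAt_of_endpointShear hκ (α.isOpen_twistDomain A hφ)
    (α.contDiffOn_twist A hφ) (g := fun p : TwistedLoopSpace φ => e p.1)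
    (fun p hp => he.mem_twistDomain (hs p hp) p.2) hcoe hη
  set h' := fderiv ℝ (α.twist A φ) (e η.1 0)
  have hev : ∀ t : I, HasMFDerivAt 𝓘(ℝ, closedPaths E) 𝓘(ℝ, E)
      (fun p : TwistedLoopSpace φ => α.kernel A (t, e p.1 t)) η
      ((mfderiv 𝓘(ℝ, E) 𝓘(ℝ, E) (fun v => α.kernel A (t, v)) (e η.1 t)).comp
        ((ContinuousMap.evalCLM ℝ t : C(I, E) →L[ℝ] E).comp G)) := by
    intro t
    have h1 : HasMFDerivAt 𝓘(ℝ, C(I, E)) 𝓘(ℝ, E) (ContinuousMap.evalCLM ℝ t : C(I, E) →L[ℝ] E)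
      (e η.1) (ContinuousMap.evalCLM ℝ t : C(I, E) →L[ℝ] E) := ContinuousLinearMap.hasMFDerivAt _
    have h2 : MDifferentiableAt 𝓘(ℝ, E) 𝓘(ℝ, E) (fun v => α.kernel A (t, v)) (e η.1 t) :=
      (α.paramSmoothAt_kernel A (he.lift_mem (e.map_source hηe) t)
        ).contMDiffAt_slice.mdifferentiableAt (by simp)
    exact HasMFDerivAt.comp (g := fun v => α.kernel A (t, v)) (f := fun p : TwistedLoopSpace φ =>
      (ContinuousMap.evalCLM ℝ t : C(I, E) →L[ℝ] E) (e p.1)) η h2.hasMFDerivAt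
      (HasMFDerivAt.comp (g := (ContinuousMap.evalCLM ℝ t : C(I, E) →L[ℝ] E)) η h1 hG)
  let B := he.frame hηe
  have hB := B.range_sec
  refine ⟨fun ξ => B.sec (G ξ), fun ξ t => ?_, B.isEmbedding_sec.comp hGe, ?_⟩
  · have h1 : (fun p : TwistedLoopSpace φ => p.1 t) =ᶠ[𝓝 η]
        fun p : TwistedLoopSpace φ => α.kernel A (t, e p.1 t) := by
      filter_upwards [κ.open_source.mem_nhds hη] with p hp
      exact (he.kernel_apply (hs p hp) t).symm
    have h2 := (hev t).congr_of_eventuallyEq h1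
    exact (congrArg (fun D => (⟨η.1 t, D ξ⟩ : TangentBundle 𝓘(ℝ, E) M)) h2.mfderiv).symm
  · ext X
    have key : ∀ f : C(I, E), B.sec f 1 = tangentMap 𝓘(ℝ, E) 𝓘(ℝ, E) φ (B.sec f 0) ↔
        f 1 = h' (f 0) := by
      intro f
      have h1 : tangentMap 𝓘(ℝ, E) 𝓘(ℝ, E) φ (B.sec f 0) = B.lift (1, h' (f 0)) :=
        he.tangentMap_frame_lift hηe hφ η.2 (f 0)
      rw [h1]
      constructor
      · intro H
        have h2 := congrArg (B.coord 1) H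
        rwa [B.coord_lift (1, h' (f 0)), show B.coord 1 (B.sec f 1) = f 1 from
          B.coord_lift (1, f 1)] at h2
      · intro H
        exact congrArg (fun v => B.lift (1, v)) H
    constructor
    · rintro ⟨ξ, rfl⟩
      exact ⟨fun t => rfl, (key _).2 ((hGr _).1 ⟨ξ, rfl⟩)⟩
    · rintro ⟨h1, h2⟩
      obtain ⟨f, rfl⟩ : X ∈ Set.range B.sec := by rw [hB]; exact h1
      obtain ⟨ξ, rfl⟩ := (hGr f).2 ((key f).1 h2)
      exact ⟨ξ, rfl⟩

end TwistedTangent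

/-! ### The main theorem: slice charts, pullback square and tangent spaces. -/

theorem mainTheorem8
    {E : Type v} [NormedAddCommGroup E] [NormedSpace ℝ E] [FiniteDimensional ℝ E]
    {M : Type u} [TopologicalSpace M] [T2Space M] [ParacompactSpace M]
    [ChartedSpace E M] [IsManifold 𝓘(ℝ, E) ∞ M]
    (φ : M ≃ₘ^∞⟮𝓘(ℝ, E), 𝓘(ℝ, E)⟯ M) :
    -- the path space carries its standard smooth structure
    (∃ (_cP : ChartedSpace C(I, E) C(I, M)) (_mP : IsManifold 𝓘(ℝ, C(I, E)) ∞ C(I, M)),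
      IsPathManifold E M) ∧
    -- and, for this structure on the path space,
    ∀ (_cP : ChartedSpace C(I, E) C(I, M)) (_mP : IsManifold 𝓘(ℝ, C(I, E)) ∞ C(I, M)),
      IsPathManifold E M →
      -- the twisted loop space is a smooth Banach manifold
      ∃ (_cL : ChartedSpace (closedPaths E) (TwistedLoopSpace φ))
        (_mL : IsManifold 𝓘(ℝ, closedPaths E) ∞ (TwistedLoopSpace φ)),
        -- which is the pullback of the endpoint map along the graph of `φ`
        (∃ (incl : BanachMfd.of (closedPaths E) (TwistedLoopSpace φ) ⟶
              BanachMfd.of C(I, E) C(I, M))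
            (ev₀ : BanachMfd.of (closedPaths E) (TwistedLoopSpace φ) ⟶ BanachMfd.of E M)
            (ends : BanachMfd.of C(I, E) C(I, M) ⟶
              (BanachMfd.of E M).prod (BanachMfd.of E M))
            (graph : BanachMfd.of E M ⟶ (BanachMfd.of E M).prod (BanachMfd.of E M)),
          (∀ γ : TwistedLoopSpace φ, BanachMfd.Hom.map incl γ = γ.1) ∧
          (∀ γ : TwistedLoopSpace φ, BanachMfd.Hom.map ev₀ γ = γ.1 0) ∧
          (∀ γ : C(I, M), BanachMfd.Hom.map ends γ = (γ 0, γ 1)) ∧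
          (∀ x : M, BanachMfd.Hom.map graph x = (x, φ x)) ∧
          CategoryTheory.IsPullback incl ev₀ ends graph) ∧
        -- and whose tangent space at `γ` is identified, linearly and topologically, with the
        -- space of continuous sections `X` along `γ` such that `X(1) = Dφ(X(0))`, by means of
        -- the derivatives of the evaluations at `t ∈ I`
        (∀ t : I, ContMDiff 𝓘(ℝ, closedPaths E) 𝓘(ℝ, E) ∞
          fun γ : TwistedLoopSpace φ => γ.1 t) ∧
        ∀ γ : TwistedLoopSpace φ,
          ∃ Θ : TangentSpace 𝓘(ℝ, closedPaths E) γ → C(I, TangentBundle 𝓘(ℝ, E) M),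
            (∀ ξ t, Θ ξ t = ⟨γ.1 t, mfderiv 𝓘(ℝ, closedPaths E) 𝓘(ℝ, E)
              (fun γ' : TwistedLoopSpace φ => γ'.1 t) γ ξ⟩) ∧
            Topology.IsEmbedding Θ ∧
            Set.range Θ = {X | (∀ t, (X t).proj = γ.1 t) ∧
              X 1 = tangentMap 𝓘(ℝ, E) 𝓘(ℝ, E) φ (X 0)} := by
  refine ⟨exists_isPathManifold E M, fun cP mP hP => ?_⟩
  have hφ : ContMDiff 𝓘(ℝ, E) 𝓘(ℝ, E) ∞ φ := φ.contMDiff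
  choose e hPe hγe using hP.covers
  choose γ' α A he using fun γ => (hPe γ).exists_isPathChartOf
  have hsl := fun γ : TwistedLoopSpace φ =>
    (he γ.1).isSliceChart_twistChart hφ (hP.mem_maximalAtlas _ (hPe γ.1))
  have hmem : ∀ γ : TwistedLoopSpace φ,
      γ.1 ∈ ((α γ.1).twistChart (A γ.1) hφ (e γ.1)).source := fun γ =>
    ⟨hγe γ.1, (he γ.1).mem_twistDomain (hγe γ.1) γ.2⟩
  let cL : ChartedSpace (closedPaths E) (TwistedLoopSpace φ) :=
    sliceChartedSpace (closedPathsProj E) closedPathsProj_coe hsl hmem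
  have mL : IsManifold 𝓘(ℝ, closedPaths E) ∞ (TwistedLoopSpace φ) :=
    isManifold_slice (closedPathsProj E) closedPathsProj_coe hsl hmem
  have hval : ContMDiff 𝓘(ℝ, closedPaths E) 𝓘(ℝ, C(I, E)) ∞
      (Subtype.val : TwistedLoopSpace φ → C(I, M)) :=
    contMDiff_slice_val (closedPathsProj E) closedPathsProj_coe hsl hmem
  have hev : ∀ t : I, ContMDiff 𝓘(ℝ, closedPaths E) 𝓘(ℝ, E) ∞
      fun γ : TwistedLoopSpace φ => γ.1 t := fun t => (hP.contMDiff_eval t).comp hval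
  refine ⟨cL, mL, ?_, hev, fun γ => ?_⟩
  · let L := BanachMfd.of (closedPaths E) (TwistedLoopSpace φ)
    let P := BanachMfd.of C(I, E) C(I, M)
    let N := BanachMfd.of E M
    let incl : L ⟶ P := BanachMfd.homMk (X := L) (Y := P) Subtype.val hval
    let ev₀ : L ⟶ N := BanachMfd.homMk (X := L) (Y := N) (fun γ => γ.1 0) (hev 0)
    let ends : P ⟶ N.prod N := BanachMfd.homMk (X := P) (Y := N.prod N) (fun γ => (γ 0, γ 1))
      (BanachMfd.contMDiff_prodMk (X := P) (Y := N) (Z := N) (hP.contMDiff_eval 0)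
        (hP.contMDiff_eval 1))
    let graph : N ⟶ N.prod N := BanachMfd.homMk (X := N) (Y := N.prod N) (fun x => (x, φ x))
      (BanachMfd.contMDiff_prodMk (X := N) (Y := N) (Z := N) contMDiff_id hφ)
    refine ⟨incl, ev₀, ends, graph, fun _ => rfl, fun _ => rfl, fun _ => rfl, fun _ => rfl, ?_⟩
    -- What remains is to factor a smooth map `Q ⟶ P` with values in the twisted loops through `L`,
    -- by initiality of the inclusion.
    refine BanachMfd.isPullback_of_graph (L := L) (P := P) (N := N)
      (a := fun γ : C(I, M) => γ 0) (b := fun γ : C(I, M) => γ 1)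
      (φ := φ) Subtype.val_injective (fun _ => rfl) (fun _ => rfl) (fun _ => rfl)
      (fun γ => γ.2) fun Q f hf => ?_
    let g : Q.carrier → TwistedLoopSpace φ := fun x => ⟨BanachMfd.Hom.map f x, hf x⟩
    exact ⟨BanachMfd.homMk (X := Q) (Y := L) g
      (contMDiff_of_slice_val (closedPathsProj E) closedPathsProj_coe hsl hmem
        (f := g) (BanachMfd.contMDiff_map f)), BanachMfd.hom_ext fun x => rfl⟩
  · have hκ : (hsl γ).chart (closedPathsProj E) closedPathsProj_coe γ ∈
        atlas (closedPaths E) (TwistedLoopSpace φ) := ⟨γ, rfl⟩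
    exact (he γ.1).exists_tangent_isEmbedding hφ
      (κ := (hsl γ).chart (closedPathsProj E) closedPathsProj_coe γ)
      (IsManifold.subset_maximalAtlas hκ) (fun p hp => hp.1)
      (fun p hp => (hsl γ).coe_chart (closedPathsProj E) closedPathsProj_coe γ hp) (hmem γ)
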